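/- **Setting.** Let $\mathcal{E}$ be a finite-dimensional real inner product space, and let $\mathcal{E}^2=\mathcal{E}\times\mathcal{E}$ carry the inner product $\langle (a,b),(c,d)\rangle_{\mathcal{E}^2}=\langle a,c\rangle_{\mathcal{E}}+\langle b,d\rangle_{\mathcal{E}}$. An *embedded ambient structure* $(\mathcal{M},\mathsf{g},\mathcal{E})$ consists of a smooth embedded submanifold $\mathcal{M}\subset\mathcal{E}$ and a smooth function $\mathsf{g}$ from $\mathcal{M}$ to the linear operators on $\mathcal{E}$ such that every $\mathsf{g}_x$ is positive-definite (self-adjoint, with $\langle\omega,\mathsf{g}_x\omega\rangle_{\mathcal{E}}>0$ for $\omega\ne 0$); $\mathcal{M}$ then carries the Riemannian metric $\langle\xi,\mathsf{g}_x\eta\rangle_{\mathcal{E}}$ on $T_x\mathcal{M}\subset\mathcal{E}$. For a subspace $V$ and a positive-definite operator $A$, the projection $\Pi$ onto $V$ corresponding to $A$ is determined by $\Pi\omega\in V$ and $\langle\Pi\omega,A\eta\rangle=\langle\omega,A\eta\rangle$ for all $\eta\in V$. Write $\Pi_{\mathsf{g},x}$ for the projection onto $T_x\mathcal{M}$ corresponding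 to $\mathsf{g}_x$. Let $\mathrm{D}_\xi$ denote the directional derivative of (scalar, vector or operator valued) functions on $\mathcal{M}$. A *Christoffel function* of $(\mathcal{M},\mathsf{g},\mathcal{E})$ is a smooth function $\Gamma$ from $\mathcal{M}$ to the $\mathcal{E}$-valued bilinear maps on $\mathcal{E}$ such that $(\nabla_XY)_x=(\mathrm{D}_XY)_x+\Gamma(X_x,Y_x)_x$ for all smooth vector fields $X,Y$ on $\mathcal{M}$ (considered as $\mathcal{E}$-valued functions) and all $x\in\mathcal{M}$, where $\nabla$ is the Levi-Civita connection of the metric induced by $\mathsf{g}$. Write $\Gamma[v]_x$ for the operator $\eta\mapsto\Gamma(\eta,v)_x$ on $\mathcal{E}$, and $\Gamma^{\mathsf{T}}[v]_x$ for its adjoint. Block matrices of operators act on $\mathcal{E}^2$ as on column vectors. The tangent bundle is $T\mathcal{M}=\{(x,v):x\in\mathcal{M},\,v\in T_x\mathcal{M}\}\subset\mathcal{E}^2$. **Theorem.** Let $(\mathcal{M},\mathsf{g},\mathcal{E})$ be an embedded ambient structure with $\dim\mathcal{M}=d$, let $\Gamma$ be a Christoffel function of it, and let $\hat{\mathsf{g}}$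 be a smooth function from $T\mathcal{M}$ to the linear operators on $\mathcal{E}$ with positive-definite values. For $(x,v)\in T\mathcal{M}$ set $$\mathsf{G}_{(x,v)}=\begin{bmatrix}I&\Gamma^{\mathsf{T}}[v]_x\\0&I\end{bmatrix}\begin{bmatrix}\mathsf{g}_x&0\\0&\hat{\mathsf{g}}_{(x,v)}\end{bmatrix}\begin{bmatrix}I&0\\\Gamma[v]_x&I\end{bmatrix}.$$ 1. $(T\mathcal{M},\mathsf{G},\mathcal{E}^2)$ is an embedded ambient structure, with $\dim T\mathcal{M}=2d$. Every $\mathsf{G}_{(x,v)}$ is invertible, and $$\mathsf{G}_{(x,v)}^{-1}=\begin{bmatrix}I&0\\-\Gamma[v]_x&I\end{bmatrix}\begin{bmatrix}\mathsf{g}_x^{-1}&0\\0&\hat{\mathsf{g}}_{(x,v)}^{-1}\end{bmatrix}\begin{bmatrix}I&-\Gamma^{\mathsf{T}}[v]_x\\0&I\end{bmatrix}.$$ 2. The induced metric is natural: for $(\Delta_{\mathfrak m},\Delta_{\mathfrak t})\in T_{(x,v)}T\mathcal{M}$ the vertical component $(0,\Delta_{\mathfrak t}+\Gamma(\Delta_{\mathfrak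 m},v)_x)$ and the horizontal component $(\Delta_{\mathfrak m},-\Gamma(\Delta_{\mathfrak m},v)_x)$ lie in $T_{(x,v)}T\mathcal{M}$; the vertical component of any vector of $T_{(x,v)}T\mathcal{M}$ is $\mathsf{G}_{(x,v)}$-orthogonal to the horizontal component of any vector of $T_{(x,v)}T\mathcal{M}$ (in particular, to that of the same vector); and $\pi:T\mathcal{M}\to\mathcal{M}$, $\pi(x,v)=x$, is a Riemannian submersion. 3. Let $\Pi_{\hat{\mathsf{g}},(x,v)}$ be the projection of $\mathcal{E}$ onto $T_x\mathcal{M}$ corresponding to $\hat{\mathsf{g}}_{(x,v)}$, and $\Pi_{\mathsf{G},(x,v)}$ the projection of $\mathcal{E}^2$ onto $T_{(x,v)}T\mathcal{M}$ corresponding to $\mathsf{G}_{(x,v)}$. Then $\Pi_{\mathsf{G}}$ is smooth on $T\mathcal{M}$ and $$\Pi_{\mathsf{G},(x,v)}=\begin{bmatrix}I&0\\-\Gamma[v]_x&I\end{bmatrix}\begin{bmatrix}\Pi_{\mathsf{g},x}&0\\0&\Pi_{\hat{\mathsf{g}},(x,v)}\end{bmatrix}\begin{bmatrix}I&0\\\Gamma[v]_x&I\end{bmatrix};$$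 in other words, for all $(\omega_{\mathfrak m},\omega_{\mathfrak t})\in\mathcal{E}^2$, $$\Pi_{\mathsf{G},(x,v)}(\omega_{\mathfrak m},\omega_{\mathfrak t})=\bigl(\Pi_{\mathsf{g},x}\omega_{\mathfrak m},\ (-\Gamma[v]_x\Pi_{\mathsf{g},x}+\Pi_{\hat{\mathsf{g}},(x,v)}\Gamma[v]_x)\omega_{\mathfrak m}+\Pi_{\hat{\mathsf{g}},(x,v)}\omega_{\mathfrak t}\bigr).$$ 4. There is a smooth function $\mathcal{X}_{\mathsf{G}}$ from $T\mathcal{M}$ to the $\mathcal{E}^2$-valued bilinear maps on $\mathcal{E}^2$ with $$\langle\tilde\phi,\mathcal{X}_{\mathsf{G}}(\tilde\xi,\tilde\eta)\rangle_{\mathcal{E}^2}=\langle\tilde\xi,(\mathrm{D}_{\tilde\phi}\mathsf{G})\tilde\eta\rangle_{\mathcal{E}^2}\qquad(*)$$ for all tangent vectors $\tilde\xi,\tilde\eta,\tilde\phi$ of $T\mathcal{M}$ at the same point, and $(T\mathcal{M},\mathsf{G},\mathcal{E}^2)$ has a Christoffel function. For every function $\mathcal{X}_{\mathsf{G}}$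 from $T\mathcal{M}$ to those bilinear maps (smooth or not) that satisfies $(*)$, every Christoffel function $\Gamma_{\mathsf{G}}$ of $(T\mathcal{M},\mathsf{G},\mathcal{E}^2)$ and all tangent vectors $\tilde\xi,\tilde\eta$ of $T\mathcal{M}$ at the same point, $$\Gamma_{\mathsf{G}}(\tilde\xi,\tilde\eta)=-(\mathrm{D}_{\tilde\xi}\Pi_{\mathsf{G}})\tilde\eta+\Pi_{\mathsf{G}}\mathsf{G}^{-1}\mathrm{K}_{\mathsf{G}}(\tilde\xi,\tilde\eta),\qquad \mathrm{K}_{\mathsf{G}}(\tilde\xi,\tilde\eta)=\tfrac12\bigl((\mathrm{D}_{\tilde\xi}\mathsf{G})\tilde\eta+(\mathrm{D}_{\tilde\eta}\mathsf{G})\tilde\xi-\mathcal{X}_{\mathsf{G}}(\tilde\xi,\tilde\eta)\bigr).$$ -/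

import Mathlib

open scoped ContDiff InnerProductSpace

noncomputable section

namespace AmbientGeometry

/-! ## The space `E²` and block operators -/

section Block

variable {E : Type*} [NormedAddCommGroup E] [InnerProductSpace ℝ E]

/-- `E² = E × E` with the inner product `⟪a, c⟫ + ⟪b, d⟫` of `(a, b)` and `(c, d)`. -/
abbrev Sq (E : Type*) : Type _ := WithLp 2 (E × E)

/-- The block operator `[[A, B], [C, D]] : (a, b) ↦ (A a + B b, C a + D b)` on `E²`. -/
def block (A B C D : E →L[ℝ] E) : Sq E →L[ℝ] Sq E :=
  ((WithLp.prodContinuousLinearEquiv 2 ℝ E E).symm : E × E →L[ℝ] Sq E) ∘L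
    ((A ∘L WithLp.fstL 2 ℝ E E + B ∘L WithLp.sndL 2 ℝ E E).prod
      (C ∘L WithLp.fstL 2 ℝ E E + D ∘L WithLp.sndL 2 ℝ E E))

theorem block_apply (A B C D : E →L[ℝ] E) (a b : E) :
    block A B C D (WithLp.toLp 2 (a, b)) = WithLp.toLp 2 (A a + B b, C a + D b) := rfl

end Block

/-! ## Submanifolds of a Euclidean space -/

section Basic

variable {E : Type*} [NormedAddCommGroup E] [InnerProductSpace ℝ E] [FiniteDimensional ℝ E]
variable {E' : Type*} [NormedAddCommGroup E'] [InnerProductSpace ℝ E'] [FiniteDimensional ℝ E']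

/-- `M` is a smooth embedded submanifold of dimension `d` of `E`: around each of its points there
is a smooth diffeomorphism between open subsets of `E` which straightens `M` to a `d`-dimensional
linear subspace. -/
def IsSubmanifold (d : ℕ) (M : Set E) : Prop :=
  ∀ x ∈ M, ∃ (φ : OpenPartialHomeomorph E E) (S : Submodule ℝ E),
    x ∈ φ.source ∧ Module.finrank ℝ S = d ∧
    ContDiffOn ℝ ∞ φ φ.source ∧ ContDiffOn ℝ ∞ φ.symm φ.target ∧
    ∀ y ∈ φ.source, (y ∈ M ↔ φ y ∈ S)

/-- The velocities at `x` of smooth curves in `M` through `x`. -/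
def velocities (M : Set E) (x : E) : Set E :=
  {ξ | ∃ c : ℝ → E, c 0 = x ∧ (∀ᶠ t in nhds (0 : ℝ), c t ∈ M) ∧ ContDiffAt ℝ ∞ c 0 ∧ deriv c 0 = ξ}

/-- The tangent space `T_x M`, as a linear subspace of `E`. For a point of a submanifold the set
of velocities already is a linear subspace, so that taking the span adds nothing. -/
def tangentSpace (M : Set E) (x : E) : Submodule ℝ E :=
  Submodule.span ℝ (velocities M x)

/-- The directional derivative `(D_ξ f)_x` of a function `f` on `M` in a tangent direction `ξ` at
`x`. For `f` smooth on the submanifold `M` and `ξ` tangent to `M`, the value at `ξ` of a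
derivative of `f` within `M` does not depend on the choice of that derivative. -/
def dirDeriv {F : Type*} [NormedAddCommGroup F] [NormedSpace ℝ F]
    (M : Set E) (f : E → F) (x ξ : E) : F :=
  fderivWithin ℝ f M x ξ

/-! ## Metric operators and projections -/

/-- Positive-definite operators: self-adjoint, with `⟪u, A u⟫ > 0` for `u ≠ 0`. -/
structure IsPosDefOp (A : E →L[ℝ] E) : Prop where
  selfAdjoint : IsSelfAdjoint A
  pos : ∀ u : E, u ≠ 0 → 0 < ⟪u, A u⟫_ℝ

/-- `(M, g, E)` is an embedded ambient structure, with `M` of dimension `d`: `M` is a submanifold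
of `E`, and `g` is a smooth function on `M` whose values are positive-definite operators on `E`.
The manifold `M` then carries the Riemannian metric `⟪ξ, g x η⟫` on its tangent spaces.
Only the values of `g` on `M` matter. -/
structure IsAmbientStructure (d : ℕ) (M : Set E) (g : E → E →L[ℝ] E) : Prop where
  submanifold : IsSubmanifold d M
  smooth : ContDiffOn ℝ ∞ g M
  posDef : ∀ x ∈ M, IsPosDefOp (g x)

/-- The projection of `E` onto the subspace `V` with respect to the inner product `⟪·, A ·⟫` of a
positive-definite operator `A`, by the formula `N (Nᵀ A N)⁻¹ Nᵀ A` where `N` is the inclusion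
of `V`; see `metricProj_mem`, `inner_metricProj` and `eq_metricProj`. -/
def metricProj (A : E →L[ℝ] E) (V : Submodule ℝ E) : E →L[ℝ] E :=
  V.subtypeL ∘L (V.subtypeL.adjoint ∘L A ∘L V.subtypeL).inverse ∘L V.subtypeL.adjoint ∘L A

theorem metricProj_mem (A : E →L[ℝ] E) (V : Submodule ℝ E) (u : E) : metricProj A V u ∈ V :=
  Subtype.property _

theorem isInvertible_compression {A : E →L[ℝ] E} (hA : IsPosDefOp A) (V : Submodule ℝ E) :
    (V.subtypeL.adjoint ∘L A ∘L V.subtypeL).IsInvertible := by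
  have hinj : Function.Injective (V.subtypeL.adjoint ∘L A ∘L V.subtypeL) := by
    rw [injective_iff_map_eq_zero]
    intro w hw
    by_contra hne
    have h1 := hA.pos (w : E) (by simpa using hne)
    have h2 : ⟪w, (V.subtypeL.adjoint ∘L A ∘L V.subtypeL) w⟫_ℝ = ⟪(w : E), A w⟫_ℝ := by
      simp [ContinuousLinearMap.adjoint_inner_right]
    rw [hw, inner_zero_right] at h2
    exact h1.ne h2
  exact ⟨(LinearEquiv.ofInjectiveEndo _ hinj).toContinuousLinearEquiv, by ext; rfl⟩

/-- The defining property of the projection. -/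
theorem inner_metricProj {A : E →L[ℝ] E} (hA : IsPosDefOp A) (V : Submodule ℝ E) (u η : E)
    (hη : η ∈ V) : ⟪metricProj A V u, A η⟫_ℝ = ⟪u, A η⟫_ℝ := by
  have hs : ∀ a b : E, ⟪a, A b⟫_ℝ = ⟪A a, b⟫_ℝ := fun a b =>
    (ContinuousLinearMap.isSelfAdjoint_iff_isSymmetric.1 hA.selfAdjoint a b).symm
  obtain ⟨e, he⟩ := isInvertible_compression hA V
  have key : V.subtypeL.adjoint (A (metricProj A V u)) = V.subtypeL.adjoint (A u) := by
    have h3 : e (e.symm (V.subtypeL.adjoint (A u))) = V.subtypeL.adjoint (A u) :=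
      e.apply_symm_apply _
    have h4 : ∀ w : V, e w = V.subtypeL.adjoint (A w) := fun w => by
      have := congrArg (fun T => T w) he
      simpa using this
    rw [h4] at h3
    simpa [metricProj, ← he] using h3
  have h5 : ∀ z : E, ⟪A z, η⟫_ℝ = ⟪V.subtypeL.adjoint (A z), (⟨η, hη⟩ : V)⟫_ℝ := fun z => by
    rw [ContinuousLinearMap.adjoint_inner_left]; rfl
  rw [hs, hs, h5, h5, key]

/-- The defining property determines the projection. -/
theorem eq_metricProj {A : E →L[ℝ] E} (hA : IsPosDefOp A) (V : Submodule ℝ E) (u θ : E)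
    (hθ : θ ∈ V) (h : ∀ η ∈ V, ⟪θ, A η⟫_ℝ = ⟪u, A η⟫_ℝ) : θ = metricProj A V u := by
  by_contra hne
  have h1 := hA.pos (θ - metricProj A V u) (sub_ne_zero.2 hne)
  have hm : θ - metricProj A V u ∈ V := V.sub_mem hθ (metricProj_mem A V u)
  rw [inner_sub_left, h _ hm, inner_metricProj hA V u _ hm, sub_self] at h1
  exact lt_irrefl _ h1

/-- The projection `Π_g`, as an operator-valued function on `M`. -/
def tangentProj (M : Set E) (g : E → E →L[ℝ] E) (x : E) : E →L[ℝ] E :=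
  metricProj (g x) (tangentSpace M x)

/-! ## The Levi-Civita connection and Christoffel functions -/

/-- Smooth vector fields on `M`, as `E`-valued functions. Only the values on `M` matter. -/
structure IsVectorField (M : Set E) (X : E → E) : Prop where
  smooth : ContDiffOn ℝ ∞ X M
  tangent : ∀ x ∈ M, X x ∈ tangentSpace M x

/-- `D` (with `D X Y` standing for `∇_X Y`) is the Levi-Civita connection of the Riemannian metric
induced by `g` on `M`. -/
structure IsLeviCivita (M : Set E) (g : E → E →L[ℝ] E) (D : (E → E) → (E → E) → E → E) :
    Prop where
  isVectorField : ∀ X Y, IsVectorField M X → IsVectorField M Y → IsVectorField M (D X Y)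
  add_left : ∀ X X' Y, IsVectorField M X → IsVectorField M X' → IsVectorField M Y →
    ∀ x ∈ M, D (X + X') Y x = D X Y x + D X' Y x
  smul_left : ∀ (f : E → ℝ) (X Y), ContDiffOn ℝ ∞ f M → IsVectorField M X → IsVectorField M Y →
    ∀ x ∈ M, D (fun y => f y • X y) Y x = f x • D X Y x
  add_right : ∀ X Y Y', IsVectorField M X → IsVectorField M Y → IsVectorField M Y' →
    ∀ x ∈ M, D X (Y + Y') x = D X Y x + D X Y' x
  leibniz : ∀ (f : E → ℝ) (X Y), ContDiffOn ℝ ∞ f M → IsVectorField M X → IsVectorField M Y →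
    ∀ x ∈ M, D X (fun y => f y • Y y) x = dirDeriv M f x (X x) • Y x + f x • D X Y x
  torsion_free : ∀ X Y, IsVectorField M X → IsVectorField M Y →
    ∀ x ∈ M, D X Y x - D Y X x = dirDeriv M Y x (X x) - dirDeriv M X x (Y x)
  metric : ∀ X Y Z, IsVectorField M X → IsVectorField M Y → IsVectorField M Z →
    ∀ x ∈ M, dirDeriv M (fun y => ⟪Y y, g y (Z y)⟫_ℝ) x (X x)
      = ⟪D X Y x, g x (Z x)⟫_ℝ + ⟪Y x, g x (D X Z x)⟫_ℝ

/-- `Γ` is smooth on `M`, as a function with values in the `E`-valued bilinear maps on `E`. -/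
def IsSmoothBilinear (M : Set E) (Γ : E → E →L[ℝ] E →L[ℝ] E) : Prop :=
  ContDiffOn ℝ ∞ Γ M

/-- `Γ` is a Christoffel function of `(M, g, E)`: a smooth function from `M` to the `E`-valued
bilinear maps on `E` with `∇_X Y = D_X Y + Γ(X, Y)` for all vector fields `X`, `Y` on `M`,
where `∇` is the Levi-Civita connection. Here `Γ x ξ η` is `Γ(ξ, η)_x`. -/
def IsChristoffel (M : Set E) (g : E → E →L[ℝ] E) (Γ : E → E →L[ℝ] E →L[ℝ] E) : Prop :=
  IsSmoothBilinear M Γ ∧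
  ∃ D : (E → E) → (E → E) → E → E, IsLeviCivita M g D ∧
    ∀ X Y, IsVectorField M X → IsVectorField M Y →
      ∀ x ∈ M, D X Y x = dirDeriv M Y x (X x) + Γ x (X x) (Y x)

/-- `𝒳` satisfies `⟪φ, 𝒳(ξ, η)⟫ = ⟪ξ, (D_φ g) η⟫` for all tangent vectors `ξ`, `η`, `φ`. -/
def IsIndexRaised (M : Set E) (g : E → E →L[ℝ] E) (𝒳 : E → E →L[ℝ] E →L[ℝ] E) : Prop :=
  ∀ x ∈ M, ∀ ξ ∈ tangentSpace M x, ∀ η ∈ tangentSpace M x, ∀ φ ∈ tangentSpace M x,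
    ⟪φ, 𝒳 x ξ η⟫_ℝ = ⟪ξ, dirDeriv M g x φ η⟫_ℝ

/-- `K_g(ξ, η) = ½ ((D_ξ g) η + (D_η g) ξ - 𝒳(ξ, η))`. -/
def christoffelK (M : Set E) (g : E → E →L[ℝ] E) (𝒳 : E → E →L[ℝ] E →L[ℝ] E) (x ξ η : E) : E :=
  (1 / 2 : ℝ) • (dirDeriv M g x ξ η + dirDeriv M g x η ξ - 𝒳 x ξ η)

/-- `Γ̊_g(ξ, η) = Π_g g⁻¹ K_g(ξ, η)`. -/
def christoffelRing (M : Set E) (g : E → E →L[ℝ] E) (𝒳 : E → E →L[ℝ] E →L[ℝ] E)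
    (x ξ η : E) : E :=
  tangentProj M g x ((g x).inverse (christoffelK M g 𝒳 x ξ η))

/-! ## Riemannian submersions -/

/-- `f` is a Riemannian submersion of `M` onto `M'`, with the Riemannian metrics induced by `g` and
`g'`: a smooth surjective submersion whose differential preserves the inner products of vectors
orthogonal to its kernel. -/
structure IsRiemannianSubmersion (M : Set E) (g : E → E →L[ℝ] E) (M' : Set E')
    (g' : E' → E' →L[ℝ] E') (f : E → E') : Prop where
  smooth : ContDiffOn ℝ ∞ f M
  image_eq : f '' M = M'
  map_tangent : ∀ x ∈ M, dirDeriv M f x '' tangentSpace M x = tangentSpace M' (f x)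
  isometry : ∀ x ∈ M, ∀ ξ ∈ tangentSpace M x, ∀ η ∈ tangentSpace M x,
    (∀ ζ ∈ tangentSpace M x, dirDeriv M f x ζ = 0 → ⟪ζ, g x ξ⟫_ℝ = 0) →
    (∀ ζ ∈ tangentSpace M x, dirDeriv M f x ζ = 0 → ⟪ζ, g x η⟫_ℝ = 0) →
    ⟪dirDeriv M f x ξ, g' (f x) (dirDeriv M f x η)⟫_ℝ = ⟪ξ, g x η⟫_ℝ

/-! ## The tangent bundle in `E²` and the operator `G` -/

/-- The tangent bundle `TM ⊆ E²`, the set of pairs `(x, v)` with `x ∈ M` and `v ∈ T_x M`. -/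
def tangentBundle (M : Set E) : Set (Sq E) :=
  {p | p.fst ∈ M ∧ p.snd ∈ tangentSpace M p.fst}

/-- `Γ[v]_x`, the operator `η ↦ Γ(η, v)_x`, at `p = (x, v)`. -/
def gammaOp (Γ : E → E →L[ℝ] E →L[ℝ] E) (p : Sq E) : E →L[ℝ] E :=
  (Γ p.fst).flip p.snd

/-- The operator `G` at `p = (x, v)`:
`[[I, Γᵀ[v]], [0, I]] · diag(g_x, ĝ_(x,v)) · [[I, 0], [Γ[v], I]]`. -/
def naturalOp (g : E → E →L[ℝ] E) (Γ : E → E →L[ℝ] E →L[ℝ] E) (gh : Sq E → E →L[ℝ] E)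
    (p : Sq E) : Sq E →L[ℝ] Sq E :=
  block 1 (gammaOp Γ p).adjoint 0 1 ∘L block (g p.fst) 0 0 (gh p) ∘L block 1 0 (gammaOp Γ p) 1

end Basic

end AmbientGeometry

end

/-! Everything about `G` follows from one description of the tangent spaces of the bundle,
`mem_tangentSpace_tangentBundle`: `(a, b)` is tangent at `(x, v)` iff `a` and `b + Γ(a, v)` both lie
in `T_x M`. The shear `(a, b) ↦ (a, b + Γ[v] a)` thus carries the tangent space to `T_x M × T_x M`,
and by `inner_naturalOp` it carries `G` to `diag(g, ĝ)`. Inverse, orthogonality, submersion and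
projection are then those of a product, sheared back.

The description comes from a straightening `φ` of `M` to `S`. The tangent map of `φ` straightens
`TM` to `S × S`, so tangency of `(a, b)` reads `Dφ a ∈ S` and `Dφ b + D²φ(a, v) ∈ S`. A vector field
`Y` through `v` satisfies the second condition with `D_a Y` in place of `b`, while `D_a Y + Γ(a, v)`
is tangent because it is a covariant derivative. Subtracting eliminates both `Y` and `D²φ`.

The Christoffel formula holds for every ambient structure (`christoffel_eq`) and is applied to `(TM,
G, E²)`. Its right-hand side defines a connection that satisfies the Levi-Civita axioms
(`isLeviCivita_christoffelMap`), and that connection is unique (`leviCivita_unique`). The fields `y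
↦ Π_y ξ` realise every tangent vector, so pointwise values can be compared. -/

noncomputable section

namespace AmbientGeometry

/-! ### Straightenings, tangent spaces and derivatives within a submanifold -/

section Submanifold

variable {E : Type*} [NormedAddCommGroup E] [InnerProductSpace ℝ E]
variable {F : Type*} [NormedAddCommGroup F] [NormedSpace ℝ F]

/-- Along a curve in `M` the chain rule makes both values the derivative of the same function of one
real variable; linearity passes to the span of the velocities. Derivatives within `M` are not unique
in normal directions, so this is what makes `dirDeriv` meaningful. -/
theorem velocity_apply_eq {M : Set E} {f : E → F} {f₁ f₂ : E →L[ℝ] F} {x : E}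
    (h₁ : HasFDerivWithinAt f f₁ M x) (h₂ : HasFDerivWithinAt f f₂ M x) {ξ : E}
    (hξ : ξ ∈ tangentSpace M x) : f₁ ξ = f₂ ξ := by
  have hle : tangentSpace M x ≤ LinearMap.eqLocus (f₁ : E →ₗ[ℝ] F) (f₂ : E →ₗ[ℝ] F) := by
    refine Submodule.span_le.2 ?_
    rintro _ ⟨c, h0, hM, hc, rfl⟩
    have hd : HasDerivAt c (deriv c 0) 0 := (hc.differentiableAt (by simp)).hasDerivAt
    subst h0
    exact (h₁.comp_hasDerivAt 0 hd hM).unique (h₂.comp_hasDerivAt 0 hd hM)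
  exact hle hξ

/-- On tangent vectors, every derivative within `M` computes the directional derivative. -/
theorem dirDeriv_eq {M : Set E} {f : E → F} {f' : E →L[ℝ] F} {x : E}
    (h : HasFDerivWithinAt f f' M x) {ξ : E} (hξ : ξ ∈ tangentSpace M x) :
    dirDeriv M f x ξ = f' ξ :=
  velocity_apply_eq h.differentiableWithinAt.hasFDerivWithinAt h hξ

theorem hasFDerivWithinAt_of_contDiffOn {M : Set E} {f : E → F} {x : E}
    (hf : ContDiffOn ℝ ∞ f M) (hx : x ∈ M) :
    HasFDerivWithinAt f (fderivWithin ℝ f M x) M x :=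
  (hf.differentiableOn (by simp) x hx).hasFDerivWithinAt

/-- `φ` is a diffeomorphism which straightens `M` to the linear subspace `S`. -/
structure IsStraightening (M : Set E) (φ : OpenPartialHomeomorph E E) (S : Submodule ℝ E) :
    Prop where
  contDiffOn : ContDiffOn ℝ ∞ φ φ.source
  contDiffOn_symm : ContDiffOn ℝ ∞ φ.symm φ.target
  mem_iff : ∀ y ∈ φ.source, (y ∈ M ↔ φ y ∈ S)

theorem IsSubmanifold.exists_straightening {d : ℕ} {M : Set E} (h : IsSubmanifold d M) {x : E}
    (hx : x ∈ M) : ∃ (φ : OpenPartialHomeomorph E E) (S : Submodule ℝ E),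
      x ∈ φ.source ∧ Module.finrank ℝ S = d ∧ IsStraightening M φ S := by
  obtain ⟨φ, S, h1, h2, h3, h4, h5⟩ := h x hx
  exact ⟨φ, S, h1, h2, h3, h4, h5⟩

namespace IsStraightening

variable {M : Set E} {φ : OpenPartialHomeomorph E E} {S : Submodule ℝ E}

theorem contDiffAt (h : IsStraightening M φ S) {x : E} (hx : x ∈ φ.source) :
    ContDiffAt ℝ ∞ φ x :=
  h.contDiffOn.contDiffAt (φ.open_source.mem_nhds hx)

theorem contDiffAt_symm (h : IsStraightening M φ S) {y : E} (hy : y ∈ φ.target) :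
    ContDiffAt ℝ ∞ φ.symm y :=
  h.contDiffOn_symm.contDiffAt (φ.open_target.mem_nhds hy)

theorem hasFDerivAt (h : IsStraightening M φ S) {x : E} (hx : x ∈ φ.source) :
    HasFDerivAt φ (fderiv ℝ φ x) x :=
  ((h.contDiffAt hx).differentiableAt (by simp)).hasFDerivAt

theorem hasFDerivAt_symm (h : IsStraightening M φ S) {y : E} (hy : y ∈ φ.target) :
    HasFDerivAt φ.symm (fderiv ℝ φ.symm y) y :=
  ((h.contDiffAt_symm hy).differentiableAt (by simp)).hasFDerivAt

theorem contDiffOn_fderiv (h : IsStraightening M φ S) :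
    ContDiffOn ℝ ∞ (fderiv ℝ φ) φ.source :=
  h.contDiffOn.fderiv_of_isOpen φ.open_source (by simp)

theorem contDiffOn_fderiv_symm (h : IsStraightening M φ S) :
    ContDiffOn ℝ ∞ (fderiv ℝ φ.symm) φ.target :=
  h.contDiffOn_symm.fderiv_of_isOpen φ.open_target (by simp)

theorem hasFDerivAt_fderiv (h : IsStraightening M φ S) {x : E} (hx : x ∈ φ.source) :
    HasFDerivAt (fderiv ℝ φ) (fderiv ℝ (fderiv ℝ φ) x) x :=
  ((h.contDiffOn_fderiv.contDiffAt (φ.open_source.mem_nhds hx)).differentiableAt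
    (by simp)).hasFDerivAt

theorem fderiv_symm_fderiv (h : IsStraightening M φ S) {x : E} (hx : x ∈ φ.source) (ξ : E) :
    fderiv ℝ φ.symm (φ x) (fderiv ℝ φ x ξ) = ξ := by
  have h1 := (h.hasFDerivAt_symm (φ.map_source hx)).comp x (h.hasFDerivAt hx)
  have h2 : HasFDerivAt (φ.symm ∘ φ) (ContinuousLinearMap.id ℝ E) x :=
    (hasFDerivAt_id x).congr_of_eventuallyEq
      (Filter.eventually_of_mem (φ.open_source.mem_nhds hx) fun y hy => φ.left_inv hy)
  exact congrArg (fun T => T ξ) (h1.unique h2)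

theorem fderiv_fderiv_symm (h : IsStraightening M φ S) {y : E} (hy : y ∈ φ.target) (η : E) :
    fderiv ℝ φ (φ.symm y) (fderiv ℝ φ.symm y η) = η := by
  have h1 := (h.hasFDerivAt (φ.map_target hy)).comp y (h.hasFDerivAt_symm hy)
  have h2 : HasFDerivAt (φ ∘ φ.symm) (ContinuousLinearMap.id ℝ E) y :=
    (hasFDerivAt_id y).congr_of_eventuallyEq
      (Filter.eventually_of_mem (φ.open_target.mem_nhds hy) fun z hz => φ.right_inv hz)
  exact congrArg (fun T => T η) (h1.unique h2)

variable [FiniteDimensional ℝ E]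

/-- The normal part of `φ` vanishes on `M`, so its derivative kills tangent vectors. Conversely, the
line through `φ x` in a direction of `S` pulls back to a curve in `M` with the required velocity. -/
theorem mem_tangentSpace_iff (h : IsStraightening M φ S) {x : E} (hx : x ∈ φ.source)
    (hxM : x ∈ M) (ξ : E) : ξ ∈ tangentSpace M x ↔ fderiv ℝ φ x ξ ∈ S := by
  constructor
  · intro hξ
    have h1 : HasFDerivWithinAt (fun y => Sᗮ.starProjection (φ y))
        (Sᗮ.starProjection ∘L fderiv ℝ φ x) M x :=
      (Sᗮ.starProjection.hasFDerivAt.comp x (h.hasFDerivAt hx)).hasFDerivWithinAt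
    have hz : ∀ y ∈ φ.source, y ∈ M → Sᗮ.starProjection (φ y) = 0 := fun y hy hyM => by
      rw [Submodule.starProjection_apply_eq_zero_iff, Submodule.orthogonal_orthogonal]
      exact (h.mem_iff y hy).1 hyM
    have h2 : HasFDerivWithinAt (fun y => Sᗮ.starProjection (φ y)) (0 : E →L[ℝ] E) M x := by
      refine (hasFDerivWithinAt_const (0 : E) x M).congr_of_eventuallyEq ?_ (hz x hx hxM)
      filter_upwards [self_mem_nhdsWithin, mem_nhdsWithin_of_mem_nhds
        (φ.open_source.mem_nhds hx)] with y hyM hy using hz y hy hyM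
    have h3 := velocity_apply_eq h1 h2 hξ
    rwa [ContinuousLinearMap.comp_apply, zero_apply,
      Submodule.starProjection_apply_eq_zero_iff, Submodule.orthogonal_orthogonal] at h3
  · intro hs
    refine Submodule.subset_span ?_
    set s := fderiv ℝ φ x ξ with hsdef
    have hl : HasDerivAt (fun t : ℝ => φ x + t • s) s 0 := by
      simpa using ((hasDerivAt_id (0 : ℝ)).smul_const s).const_add (φ x)
    have hlc : ContDiff ℝ ∞ (fun t : ℝ => φ x + t • s) :=
      contDiff_const.add (contDiff_id.smul contDiff_const)
    have hev : ∀ᶠ t : ℝ in nhds 0, φ x + t • s ∈ φ.target :=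
      hlc.continuous.continuousAt.eventually_mem
        (φ.open_target.mem_nhds (by simpa using φ.map_source hx))
    refine ⟨fun t => φ.symm (φ x + t • s), by simp [φ.left_inv hx], ?_, ?_, ?_⟩
    · filter_upwards [hev] with t ht
      rw [h.mem_iff _ (φ.map_target ht), φ.right_inv ht]
      exact S.add_mem ((h.mem_iff x hx).1 hxM) (S.smul_mem _ hs)
    · exact ContDiffAt.comp (0 : ℝ) (h.contDiffAt_symm (by simpa using φ.map_source hx))
        hlc.contDiffAt
    · have h1 : HasFDerivAt φ.symm (fderiv ℝ φ.symm (φ x)) (φ x + (0 : ℝ) • s) := by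
        simpa using h.hasFDerivAt_symm (φ.map_source hx)
      have h2 := h1.comp_hasDerivAt (0 : ℝ) hl
      rw [hsdef, h.fderiv_symm_fderiv hx] at h2
      exact h2.deriv

theorem tangentSpace_eq_map (h : IsStraightening M φ S) {x : E} (hx : x ∈ φ.source)
    (hxM : x ∈ M) (ξ : E) :
    ξ ∈ tangentSpace M x ↔ ∃ s ∈ S, fderiv ℝ φ.symm (φ x) s = ξ := by
  rw [h.mem_tangentSpace_iff hx hxM]
  constructor
  · exact fun hs => ⟨_, hs, h.fderiv_symm_fderiv hx ξ⟩
  · rintro ⟨s, hs, rfl⟩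
    have := h.fderiv_fderiv_symm (φ.map_source hx) s
    rw [φ.left_inv hx] at this
    rwa [this]

/-- Smooth functions on `M` extend locally to smooth functions on the ambient space. -/
theorem exists_extension (h : IsStraightening M φ S) {x : E} (hx : x ∈ φ.source) (hxM : x ∈ M)
    {f : E → F} (hf : ContDiffOn ℝ ∞ f M) :
    ∃ (U : Set E) (f' : E → F), IsOpen U ∧ x ∈ U ∧ ContDiffOn ℝ ∞ f' U ∧
      ∀ y ∈ U, y ∈ M → f' y = f y := by
  set P := S.starProjection
  have hP : ∀ y ∈ φ.source, y ∈ M → P (φ y) = φ y := fun y hy hyM =>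
    Submodule.starProjection_eq_self_iff.2 ((h.mem_iff y hy).1 hyM)
  -- The extension is `f` composed with the local retraction `φ⁻¹ ∘ P ∘ φ` onto `M`; the open set is
  -- where this retraction is defined.
  refine ⟨φ.source ∩ (fun y => P (φ y)) ⁻¹' φ.target, fun y => f (φ.symm (P (φ y))), ?_, ?_, ?_, ?_⟩
  · exact (P.continuous.comp_continuousOn φ.continuousOn).isOpen_inter_preimage
      φ.open_source φ.open_target
  · exact ⟨hx, by simpa [hP x hx hxM] using φ.map_source hx⟩
  · refine hf.comp (h.contDiffOn_symm.comp (P.contDiff.comp_contDiffOn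
      (h.contDiffOn.mono Set.inter_subset_left)) fun y hy => hy.2) ?_
    rintro y ⟨hy, hy'⟩
    refine (h.mem_iff _ (φ.map_target hy')).2 ?_
    refine Eq.mpr (congrArg (· ∈ S) (φ.right_inv hy')) ?_
    exact Submodule.starProjection_apply_mem _ _
  · rintro y ⟨hy, -⟩ hyM
    simp only [hP y hy hyM, φ.left_inv hy]

end IsStraightening

variable [FiniteDimensional ℝ E]

/-- The directional derivatives of a smooth function along smooth fields of operators with
tangent values are smooth. -/
theorem contDiffOn_fderivWithin_comp {d : ℕ} {M : Set E} (hM : IsSubmanifold d M) {f : E → F}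
    (hf : ContDiffOn ℝ ∞ f M) {V : Type*} [NormedAddCommGroup V] [NormedSpace ℝ V]
    {P : E → V →L[ℝ] E} (hP : ContDiffOn ℝ ∞ P M)
    (hPt : ∀ x ∈ M, ∀ v, P x v ∈ tangentSpace M x) :
    ContDiffOn ℝ ∞ (fun x => fderivWithin ℝ f M x ∘L P x) M := by
  intro x hx
  obtain ⟨φ, S, hxs, -, hφ⟩ := hM.exists_straightening hx
  obtain ⟨U, f', hU, hxU, hf', hff'⟩ := hφ.exists_extension hxs hx hf
  -- `fderivWithin` depends on a choice in normal directions, so it need not be smooth by itself;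
  -- composed with tangent-valued `P` it agrees with the derivative of a smooth extension.
  have hkey : ∀ y ∈ U, y ∈ M → fderivWithin ℝ f M y ∘L P y = fderiv ℝ f' y ∘L P y := by
    intro y hy hyM
    have h1 : HasFDerivWithinAt f' (fderiv ℝ f' y) M y :=
      ((hf'.contDiffAt (hU.mem_nhds hy)).differentiableAt (by simp)).hasFDerivAt.hasFDerivWithinAt
    have h2 : HasFDerivWithinAt f (fderiv ℝ f' y) M y := by
      refine h1.congr_of_eventuallyEq ?_ (hff' y hy hyM).symm
      filter_upwards [self_mem_nhdsWithin, mem_nhdsWithin_of_mem_nhds (hU.mem_nhds hy)]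
        with z hzM hz using (hff' z hz hzM).symm
    ext v
    exact dirDeriv_eq h2 (hPt y hyM v)
  have hs : ContDiffWithinAt ℝ ∞ (fun y => fderiv ℝ f' y ∘L P y) M x :=
    (((hf'.fderiv_of_isOpen hU (m := ∞) (by simp)).contDiffAt
      (hU.mem_nhds hxU)).contDiffWithinAt).clm_comp (hP x hx)
  refine hs.congr_of_eventuallyEq ?_ (hkey x hxU hx)
  filter_upwards [self_mem_nhdsWithin, mem_nhdsWithin_of_mem_nhds (hU.mem_nhds hxU)]
    with y hyM hy using hkey y hy hyM

/-- The derivative of the equation `Dφ Y ∈ S` of a vector field. -/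
theorem IsStraightening.fderiv_dirDeriv_add_mem {M : Set E} {φ : OpenPartialHomeomorph E E}
    {S : Submodule ℝ E} (h : IsStraightening M φ S) {x : E} (hx : x ∈ φ.source) (hxM : x ∈ M)
    {Y : E → E} (hY : IsVectorField M Y) {ξ : E} (hξ : ξ ∈ tangentSpace M x) :
    fderiv ℝ φ x (dirDeriv M Y x ξ) + fderiv ℝ (fderiv ℝ φ) x ξ (Y x) ∈ S := by
  have h1 := (h.hasFDerivAt_fderiv hx).hasFDerivWithinAt.clm_apply
    (hasFDerivWithinAt_of_contDiffOn hY.smooth hxM)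
  have h2 := Sᗮ.starProjection.hasFDerivAt.comp_hasFDerivWithinAt x h1
  have hz : ∀ y ∈ φ.source, y ∈ M → Sᗮ.starProjection (fderiv ℝ φ y (Y y)) = 0 := by
    intro y hy hyM
    rw [Submodule.starProjection_apply_eq_zero_iff, Submodule.orthogonal_orthogonal]
    exact (h.mem_tangentSpace_iff hy hyM _).1 (hY.tangent y hyM)
  have h3 : HasFDerivWithinAt (Sᗮ.starProjection ∘ fun y => fderiv ℝ φ y (Y y))
      (0 : E →L[ℝ] E) M x := by
    refine (hasFDerivWithinAt_const (0 : E) x M).congr_of_eventuallyEq ?_ (hz x hx hxM)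
    filter_upwards [self_mem_nhdsWithin, mem_nhdsWithin_of_mem_nhds
      (φ.open_source.mem_nhds hx)] with y hyM hy using hz y hy hyM
  have h4 := velocity_apply_eq h2 h3 hξ
  simp only [ContinuousLinearMap.comp_apply, zero_apply,
    Submodule.starProjection_apply_eq_zero_iff, Submodule.orthogonal_orthogonal] at h4
  exact h4

/-- The Lie bracket of vector fields on `M` is tangent to `M`. -/
theorem lieBracket_mem_tangentSpace {d : ℕ} {M : Set E} (hM : IsSubmanifold d M) {X Y : E → E}
    (hX : IsVectorField M X) (hY : IsVectorField M Y) {x : E} (hx : x ∈ M) :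
    dirDeriv M Y x (X x) - dirDeriv M X x (Y x) ∈ tangentSpace M x := by
  obtain ⟨φ, S, hxs, -, hφ⟩ := hM.exists_straightening hx
  -- Symmetry of `D²φ` cancels the second-order terms of the two differentiated tangency equations.
  have hsymm : fderiv ℝ (fderiv ℝ φ) x (X x) (Y x) = fderiv ℝ (fderiv ℝ φ) x (Y x) (X x) :=
    (hφ.contDiffAt hxs).isSymmSndFDerivAt
      (by rw [minSmoothness_of_isRCLikeNormedField]; exact ENat.LEInfty.out) _ _
  rw [hφ.mem_tangentSpace_iff hxs hx, map_sub]
  have := S.sub_mem (hφ.fderiv_dirDeriv_add_mem hxs hx hY (hX.tangent x hx))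
    (hφ.fderiv_dirDeriv_add_mem hxs hx hX (hY.tangent x hx))
  rwa [hsymm, add_sub_add_right_eq_sub] at this

end Submanifold

/-! ### Positive-definite operators, their compressions and projections -/

section Operators

theorem contDiffWithinAt_inverse {X E W : Type*} [NormedAddCommGroup X] [NormedSpace ℝ X]
    [NormedAddCommGroup E] [NormedSpace ℝ E] [NormedAddCommGroup W] [NormedSpace ℝ W]
    [CompleteSpace W] {n : WithTop ℕ∞} {f : X → W →L[ℝ] E} {s : Set X} {x : X}
    (hf : ContDiffWithinAt ℝ n f s x) (hi : (f x).IsInvertible) :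
    ContDiffWithinAt ℝ n (fun y => (f y).inverse) s x := by
  obtain ⟨e, he⟩ := hi
  have h1 := contDiffAt_map_inverse (n := n) e
  rw [he] at h1
  exact h1.comp_contDiffWithinAt x hf

variable {E : Type*} [NormedAddCommGroup E] [InnerProductSpace ℝ E] [FiniteDimensional ℝ E]
variable {W : Type*} [NormedAddCommGroup W] [InnerProductSpace ℝ W] [FiniteDimensional ℝ W]
variable {X : Type*} [NormedAddCommGroup X] [NormedSpace ℝ X]

/-- The adjoint, as a continuous linear map on operators. -/
def adjointCLM (E W : Type*) [NormedAddCommGroup E] [InnerProductSpace ℝ E]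
    [FiniteDimensional ℝ E] [NormedAddCommGroup W] [InnerProductSpace ℝ W]
    [FiniteDimensional ℝ W] : (W →L[ℝ] E) →L[ℝ] (E →L[ℝ] W) :=
  (ContinuousLinearMap.adjoint (𝕜 := ℝ) (E := W) (F := E)).toLinearIsometry.toContinuousLinearMap

theorem adjointCLM_apply (A : W →L[ℝ] E) : adjointCLM E W A = A.adjoint := rfl

theorem contDiffWithinAt_adjoint {n : WithTop ℕ∞} {f : X → W →L[ℝ] E} {s : Set X} {x : X}
    (hf : ContDiffWithinAt ℝ n f s x) : ContDiffWithinAt ℝ n (fun y => (f y).adjoint) s x :=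
  (adjointCLM E W).contDiff.contDiffAt.comp_contDiffWithinAt x hf

theorem isInvertible_of_forall_apply_eq_zero {A : E →L[ℝ] E} (h : ∀ u, A u = 0 → u = 0) :
    A.IsInvertible :=
  ⟨(LinearEquiv.ofInjectiveEndo _ ((injective_iff_map_eq_zero A).2 h)).toContinuousLinearEquiv,
    by ext; rfl⟩

namespace IsPosDefOp

variable {A : E →L[ℝ] E}

theorem inner_apply (hA : IsPosDefOp A) (a b : E) : ⟪a, A b⟫_ℝ = ⟪A a, b⟫_ℝ :=
  (ContinuousLinearMap.isSelfAdjoint_iff_isSymmetric.1 hA.selfAdjoint a b).symm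

theorem eq_zero_of_inner (hA : IsPosDefOp A) {u : E} (h : ⟪u, A u⟫_ℝ = 0) : u = 0 := by
  by_contra hne
  exact (hA.pos u hne).ne' h

theorem isInvertible (hA : IsPosDefOp A) : A.IsInvertible :=
  isInvertible_of_forall_apply_eq_zero fun u hu => hA.eq_zero_of_inner (by rw [hu, inner_zero_right])

/-- The compression of a positive-definite operator along an injective map. -/
theorem isInvertible_compression_of_injective (hA : IsPosDefOp A) {L : W →L[ℝ] E}
    (hL : Function.Injective L) : (L.adjoint ∘L A ∘L L).IsInvertible := by
  refine isInvertible_of_forall_apply_eq_zero fun w hw => hL ?_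
  rw [map_zero]
  refine hA.eq_zero_of_inner ?_
  rw [← ContinuousLinearMap.adjoint_inner_right]
  change ⟪w, (L.adjoint ∘L A ∘L L) w⟫_ℝ = 0
  rw [hw, inner_zero_right]

/-- The projection onto the range of an injective map. -/
theorem metricProj_eq (hA : IsPosDefOp A) {L : W →L[ℝ] E} (hL : Function.Injective L)
    {V : Submodule ℝ E} (hV : ∀ ξ, ξ ∈ V ↔ ∃ w, L w = ξ) :
    metricProj A V = L ∘L (L.adjoint ∘L A ∘L L).inverse ∘L L.adjoint ∘L A := by
  ext u
  symm
  refine eq_metricProj hA V u _ ((hV _).2 ⟨_, rfl⟩) ?_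
  intro η hη
  obtain ⟨w, rfl⟩ := (hV η).1 hη
  have h1 : L.adjoint (A (L ((L.adjoint ∘L A ∘L L).inverse (L.adjoint (A u))))) =
      L.adjoint (A u) :=
    ((hA.isInvertible_compression_of_injective hL).inverse_apply_eq.1 rfl).symm
  simp only [ContinuousLinearMap.comp_apply]
  rw [hA.inner_apply, hA.inner_apply, ← ContinuousLinearMap.adjoint_inner_left, h1,
    ContinuousLinearMap.adjoint_inner_left]

theorem metricProj_eq_self (hA : IsPosDefOp A) {V : Submodule ℝ E} {ξ : E} (hξ : ξ ∈ V) :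
    metricProj A V ξ = ξ :=
  (eq_metricProj hA V ξ ξ hξ fun _ _ => rfl).symm

/-- `Π A⁻¹` is the Riesz map of `V` for the inner product of `A`: it represents the functional `⟪u,
·⟫` on `V`. -/
theorem inner_metricProj_inverse (hA : IsPosDefOp A) {V : Submodule ℝ E} (u : E) {η : E}
    (hη : η ∈ V) : ⟪metricProj A V (A.inverse u), A η⟫_ℝ = ⟪u, η⟫_ℝ := by
  rw [inner_metricProj hA V _ _ hη, hA.inner_apply,
    ← hA.isInvertible.inverse_apply_eq.1 (rfl : A.inverse u = _)]

/-- Vectors of a subspace are determined by their products with vectors of the subspace. -/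
theorem eq_of_inner (hA : IsPosDefOp A) {V : Submodule ℝ E} {ξ ξ' : E} (hξ : ξ ∈ V)
    (hξ' : ξ' ∈ V) (h : ∀ η ∈ V, ⟪ξ, A η⟫_ℝ = ⟪ξ', A η⟫_ℝ) : ξ = ξ' := by
  rw [← sub_eq_zero]
  refine hA.eq_zero_of_inner ?_
  rw [inner_sub_left, h _ (V.sub_mem hξ hξ'), sub_self]

end IsPosDefOp

end Operators

/-! ### Levi-Civita connection and Christoffel functions of an ambient structure -/

section Ambient

variable {E : Type*} [NormedAddCommGroup E] [InnerProductSpace ℝ E] [FiniteDimensional ℝ E]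
variable {d : ℕ} {M : Set E} {g : E → E →L[ℝ] E}

namespace IsAmbientStructure

theorem tangentProj_eq_self (h : IsAmbientStructure d M g) {x : E} (hx : x ∈ M) {ξ : E}
    (hξ : ξ ∈ tangentSpace M x) : tangentProj M g x ξ = ξ :=
  (h.posDef x hx).metricProj_eq_self hξ

/-- Near each point the tangent spaces are the ranges of injective maps `L y` from one fixed space
`S`, smooth in `y`. The formula `L (Lᵀ g L)⁻¹ Lᵀ g` is then visibly smooth. -/
theorem contDiffOn_tangentProj (h : IsAmbientStructure d M g) :
    ContDiffOn ℝ ∞ (tangentProj M g) M := by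
  intro x hx
  obtain ⟨φ, S, hxs, -, hφ⟩ := h.submanifold.exists_straightening hx
  set L : E → S →L[ℝ] E := fun y => fderiv ℝ φ.symm (φ y) ∘L S.subtypeL with hLdef
  have hL : ContDiffWithinAt ℝ ∞ L M x := by
    have h1 : ContDiffAt ℝ ∞ (fderiv ℝ φ.symm) (φ x) :=
      hφ.contDiffOn_fderiv_symm.contDiffAt (φ.open_target.mem_nhds (φ.map_source hxs))
    exact (ContDiffAt.comp x h1 (hφ.contDiffAt hxs)).contDiffWithinAt.clm_comp
      contDiffWithinAt_const
  have hinj : ∀ y ∈ φ.source, Function.Injective (L y) := fun y hy a b hab => by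
    have h2 := congrArg (fderiv ℝ φ (φ.symm (φ y))) hab
    simp only [hLdef, ContinuousLinearMap.comp_apply] at h2
    rw [hφ.fderiv_fderiv_symm (φ.map_source hy), hφ.fderiv_fderiv_symm (φ.map_source hy)] at h2
    exact Subtype.ext h2
  have heq : ∀ y ∈ φ.source, y ∈ M → tangentProj M g y =
      L y ∘L ((L y).adjoint ∘L g y ∘L L y).inverse ∘L (L y).adjoint ∘L g y := by
    intro y hy hyM
    refine (h.posDef y hyM).metricProj_eq (hinj y hy) fun ξ => ?_
    rw [hφ.tangentSpace_eq_map hy hyM]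
    simp [hLdef]
  have hg := h.smooth x hx
  have hLa := contDiffWithinAt_adjoint hL
  have hs := hL.clm_comp ((contDiffWithinAt_inverse (hLa.clm_comp (hg.clm_comp hL))
    ((h.posDef x hx).isInvertible_compression_of_injective (hinj x hxs))).clm_comp
      (hLa.clm_comp hg))
  refine hs.congr_of_eventuallyEq ?_ (heq x hxs hx)
  filter_upwards [self_mem_nhdsWithin, mem_nhdsWithin_of_mem_nhds
    (φ.open_source.mem_nhds hxs)] with y hyM hy using heq y hy hyM

/-- Extends any tangent vector to a global smooth vector field without cutoff functions, since `Π`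
fixes tangent vectors. -/
theorem isVectorField_tangentProj (h : IsAmbientStructure d M g) (ξ : E) :
    IsVectorField M fun y => tangentProj M g y ξ :=
  ⟨h.contDiffOn_tangentProj.clm_apply contDiffOn_const, fun _ _ => metricProj_mem _ _ _⟩

theorem contDiffOn_inverse (h : IsAmbientStructure d M g) :
    ContDiffOn ℝ ∞ (fun x => (g x).inverse) M := fun x hx =>
  contDiffWithinAt_inverse (h.smooth x hx) (h.posDef x hx).isInvertible

/-- On `M` the functions `g` and `gᵀ` coincide, so the derivative and its adjoint are both
derivatives of `g` within `M` and agree in tangent directions. -/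
theorem inner_dirDeriv_comm (h : IsAmbientStructure d M g) {x : E} (hx : x ∈ M) {ζ : E}
    (hζ : ζ ∈ tangentSpace M x) (a b : E) :
    ⟪a, dirDeriv M g x ζ b⟫_ℝ = ⟪b, dirDeriv M g x ζ a⟫_ℝ := by
  have h1 := hasFDerivWithinAt_of_contDiffOn h.smooth hx
  have h2 := (adjointCLM E E).hasFDerivAt.comp_hasFDerivWithinAt x h1
  have h3 : HasFDerivWithinAt g (adjointCLM E E ∘L fderivWithin ℝ g M x) M x :=
    h2.congr (fun y hy => ((h.posDef y hy).selfAdjoint).symm) ((h.posDef x hx).selfAdjoint).symm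
  have h4 := velocity_apply_eq h1 h3 hζ
  change ⟪a, fderivWithin ℝ g M x ζ b⟫_ℝ = _
  rw [h4, ContinuousLinearMap.comp_apply, adjointCLM_apply,
    ContinuousLinearMap.adjoint_inner_right, real_inner_comm]
  rfl

end IsAmbientStructure

/-- The derivative of `f` in the direction of the projection onto the tangent space. -/
def projDeriv {F : Type*} [NormedAddCommGroup F] [NormedSpace ℝ F] (M : Set E)
    (g : E → E →L[ℝ] E) (f : E → F) (x : E) : E →L[ℝ] F :=
  fderivWithin ℝ f M x ∘L tangentProj M g x

theorem IsAmbientStructure.contDiffOn_projDeriv {F : Type*} [NormedAddCommGroup F]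
    [NormedSpace ℝ F] (h : IsAmbientStructure d M g) {f : E → F} (hf : ContDiffOn ℝ ∞ f M) :
    ContDiffOn ℝ ∞ (projDeriv M g f) M :=
  contDiffOn_fderivWithin_comp h.submanifold hf h.contDiffOn_tangentProj
    fun _ _ _ => metricProj_mem _ _ _

theorem IsAmbientStructure.projDeriv_apply {F : Type*} [NormedAddCommGroup F]
    [NormedSpace ℝ F] (h : IsAmbientStructure d M g) (f : E → F) {x : E} (hx : x ∈ M) {ξ : E}
    (hξ : ξ ∈ tangentSpace M x) : projDeriv M g f x ξ = dirDeriv M f x ξ := by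
  rw [projDeriv, ContinuousLinearMap.comp_apply, h.tangentProj_eq_self hx hξ]
  rfl

/-- The bilinear map with `⟪φ, 𝒳(ξ, η)⟫ = ⟪ξ, (D_(Π φ) g) η⟫`. -/
def indexRaised (M : Set E) (g : E → E →L[ℝ] E) (x : E) : E →L[ℝ] E →L[ℝ] E :=
  (adjointCLM E E ∘L (projDeriv M g g x).flip).flip

theorem contDiffOn_flip {X F₁ F₂ F₃ : Type*} [NormedAddCommGroup X] [NormedSpace ℝ X]
    [NormedAddCommGroup F₁] [NormedSpace ℝ F₁] [NormedAddCommGroup F₂] [NormedSpace ℝ F₂]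
    [NormedAddCommGroup F₃] [NormedSpace ℝ F₃] {s : Set X} {f : X → F₁ →L[ℝ] F₂ →L[ℝ] F₃}
    {n : WithTop ℕ∞} (hf : ContDiffOn ℝ n f s) : ContDiffOn ℝ n (fun x => (f x).flip) s := by
  have h : ContDiff ℝ n (ContinuousLinearMap.flipₗᵢ ℝ F₁ F₂ F₃) :=
    LinearIsometryEquiv.contDiff _
  exact h.comp_contDiffOn hf

namespace IsAmbientStructure

theorem isSmoothBilinear_indexRaised (h : IsAmbientStructure d M g) :
    IsSmoothBilinear M (indexRaised M g) :=
  contDiffOn_flip (contDiffOn_const.clm_comp (contDiffOn_flip (h.contDiffOn_projDeriv h.smooth)))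

theorem isIndexRaised_indexRaised (h : IsAmbientStructure d M g) :
    IsIndexRaised M g (indexRaised M g) := by
  intro x hx ξ _ η _ φ hφ
  change ⟪φ, ((projDeriv M g g x).flip η).adjoint ξ⟫_ℝ = _
  rw [ContinuousLinearMap.adjoint_inner_right, real_inner_comm, ContinuousLinearMap.flip_apply,
    h.projDeriv_apply g hx hφ]

/-- The inner products of `Π g⁻¹ K` with tangent vectors. -/
theorem inner_christoffelRing (h : IsAmbientStructure d M g) {𝒳 : E → E →L[ℝ] E →L[ℝ] E}
    (h𝒳 : IsIndexRaised M g 𝒳) {x : E} (hx : x ∈ M) {ξ η ζ : E} (hξ : ξ ∈ tangentSpace M x)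
    (hη : η ∈ tangentSpace M x) (hζ : ζ ∈ tangentSpace M x) :
    ⟪christoffelRing M g 𝒳 x ξ η, g x ζ⟫_ℝ = (1 / 2 : ℝ) * (⟪ζ, dirDeriv M g x ξ η⟫_ℝ +
      ⟪ζ, dirDeriv M g x η ξ⟫_ℝ - ⟪ξ, dirDeriv M g x ζ η⟫_ℝ) := by
  rw [christoffelRing, tangentProj, (h.posDef x hx).inner_metricProj_inverse _ hζ,
    real_inner_comm, christoffelK, inner_smul_right, inner_sub_right, inner_add_right,
    h𝒳 x hx ξ hξ η hη ζ hζ]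

/-- `Π g⁻¹` sees only pairings with tangent vectors, and these are all that the condition on `𝒳`
prescribes. -/
theorem christoffelRing_eq (h : IsAmbientStructure d M g) {𝒳 𝒳' : E → E →L[ℝ] E →L[ℝ] E}
    (h𝒳 : IsIndexRaised M g 𝒳) (h𝒳' : IsIndexRaised M g 𝒳') {x : E} (hx : x ∈ M) {ξ η : E}
    (hξ : ξ ∈ tangentSpace M x) (hη : η ∈ tangentSpace M x) :
    christoffelRing M g 𝒳 x ξ η = christoffelRing M g 𝒳' x ξ η := by
  refine (h.posDef x hx).eq_of_inner (metricProj_mem _ _ _) (metricProj_mem _ _ _)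
    fun ζ hζ => ?_
  rw [h.inner_christoffelRing h𝒳 hx hξ hη hζ, h.inner_christoffelRing h𝒳' hx hξ hη hζ]

end IsAmbientStructure

/-- A Christoffel function of `(M, g, E)`. -/
def christoffelMap (M : Set E) (g : E → E →L[ℝ] E) (x : E) : E →L[ℝ] E →L[ℝ] E :=
  -projDeriv M g (tangentProj M g) x +
    ContinuousLinearMap.compL ℝ E E E (tangentProj M g x ∘L (g x).inverse) ∘L
      ((1 / 2 : ℝ) • (projDeriv M g g x + (projDeriv M g g x).flip - indexRaised M g x))

namespace IsAmbientStructure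

theorem contDiffOn_christoffelMap (h : IsAmbientStructure d M g) :
    ContDiffOn ℝ ∞ (christoffelMap M g) M := by
  have hg := h.contDiffOn_projDeriv h.smooth
  have hL : ContDiff ℝ ∞ (ContinuousLinearMap.compL ℝ E E E) :=
    ContinuousLinearMap.contDiff _
  have hc := hL.comp_contDiffOn (h.contDiffOn_tangentProj.clm_comp h.contDiffOn_inverse)
  refine (h.contDiffOn_projDeriv h.contDiffOn_tangentProj).neg.add (hc.clm_comp ?_)
  exact ((hg.add (contDiffOn_flip hg)).sub h.isSmoothBilinear_indexRaised).const_smul _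

theorem christoffelMap_apply (h : IsAmbientStructure d M g) {x : E} (hx : x ∈ M) {ξ η : E}
    (hξ : ξ ∈ tangentSpace M x) (hη : η ∈ tangentSpace M x) :
    christoffelMap M g x ξ η = -(dirDeriv M (tangentProj M g) x ξ η) +
      christoffelRing M g (indexRaised M g) x ξ η := by
  simp only [christoffelMap, christoffelRing, christoffelK]
  simp [h.projDeriv_apply _ hx hξ, h.projDeriv_apply _ hx hη]

/-- The covariant derivative given by `christoffelMap`. -/
theorem dirDeriv_add_christoffelMap (h : IsAmbientStructure d M g) {Y : E → E}
    (hY : IsVectorField M Y) {x : E} (hx : x ∈ M) {ξ : E} (hξ : ξ ∈ tangentSpace M x) :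
    dirDeriv M Y x ξ + christoffelMap M g x ξ (Y x) = tangentProj M g x (dirDeriv M Y x ξ) +
      christoffelRing M g (indexRaised M g) x ξ (Y x) := by
  -- Differentiating `Y = Π Y` gives `D_ξ Y = (D_ξ Π) Y + Π D_ξ Y`; the term `-(D_ξ Π) Y` of the
  -- Christoffel map leaves just `Π D_ξ Y`.
  have h1 := (hasFDerivWithinAt_of_contDiffOn h.contDiffOn_tangentProj hx).clm_apply
    (hasFDerivWithinAt_of_contDiffOn hY.smooth hx)
  have h2 : HasFDerivWithinAt Y _ M x := h1.congr
    (fun y hy => (h.tangentProj_eq_self hy (hY.tangent y hy)).symm)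
    (h.tangentProj_eq_self hx (hY.tangent x hx)).symm
  have h3 := dirDeriv_eq h2 hξ
  rw [h.christoffelMap_apply hx hξ (hY.tangent x hx)]
  nth_rewrite 1 [h3]
  simp only [add_apply, ContinuousLinearMap.comp_apply, ContinuousLinearMap.flip_apply]
  unfold dirDeriv
  abel

/-- A Koszul-type formula, from which torsion-freeness and metric compatibility become algebra. -/
theorem inner_dirDeriv_add_christoffelMap (h : IsAmbientStructure d M g) {Y : E → E}
    (hY : IsVectorField M Y) {x : E} (hx : x ∈ M) {ξ ζ : E} (hξ : ξ ∈ tangentSpace M x)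
    (hζ : ζ ∈ tangentSpace M x) :
    ⟪dirDeriv M Y x ξ + christoffelMap M g x ξ (Y x), g x ζ⟫_ℝ =
      ⟪dirDeriv M Y x ξ, g x ζ⟫_ℝ + (1 / 2 : ℝ) * (⟪ζ, dirDeriv M g x ξ (Y x)⟫_ℝ +
      ⟪ζ, dirDeriv M g x (Y x) ξ⟫_ℝ - ⟪ξ, dirDeriv M g x ζ (Y x)⟫_ℝ) := by
  rw [h.dirDeriv_add_christoffelMap hY hx hξ, inner_add_left,
    h.inner_christoffelRing h.isIndexRaised_indexRaised hx hξ (hY.tangent x hx) hζ,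
    tangentProj, inner_metricProj (h.posDef x hx) _ _ _ hζ]

theorem isLeviCivita_christoffelMap (h : IsAmbientStructure d M g) :
    IsLeviCivita M g fun X Y x => dirDeriv M Y x (X x) + christoffelMap M g x (X x) (Y x) where
  isVectorField X Y hX hY := by
    refine ⟨?_, fun x hx => ?_⟩
    · refine ContDiffOn.add ?_ ((h.contDiffOn_christoffelMap.clm_apply hX.smooth).clm_apply
        hY.smooth)
      exact ((h.contDiffOn_projDeriv hY.smooth).clm_apply hX.smooth).congr
        fun x hx => (h.projDeriv_apply Y hx (hX.tangent x hx)).symm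
    · rw [h.dirDeriv_add_christoffelMap hY hx (hX.tangent x hx)]
      exact Submodule.add_mem _ (metricProj_mem _ _ _) (metricProj_mem _ _ _)
  add_left X X' Y _ _ _ x _ := by
    simp only [dirDeriv, Pi.add_apply, map_add, add_apply]
    abel
  smul_left f X Y _ _ _ x _ := by
    simp only [dirDeriv, map_smul, smul_apply, smul_add]
  add_right X Y Y' hX hY hY' x hx := by
    have h1 := dirDeriv_eq ((hasFDerivWithinAt_of_contDiffOn hY.smooth hx).add
      (hasFDerivWithinAt_of_contDiffOn hY'.smooth hx)) (hX.tangent x hx)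
    change dirDeriv M (Y + Y') x (X x) + _ = _
    rw [h1]
    simp only [dirDeriv, Pi.add_apply, map_add, add_apply]
    abel
  leibniz f X Y hf hX hY x hx := by
    have h1 := dirDeriv_eq ((hasFDerivWithinAt_of_contDiffOn hf hx).smul
      (hasFDerivWithinAt_of_contDiffOn hY.smooth hx)) (hX.tangent x hx)
    change dirDeriv M (f • Y) x (X x) + _ = _
    rw [h1]
    simp only [dirDeriv, map_smul, add_apply, smul_apply, smul_add,
      ContinuousLinearMap.smulRight_apply]
    abel
  torsion_free X Y hX hY x hx := by
    have hXx := hX.tangent x hx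
    have hYx := hY.tangent x hx
    -- Both sides are tangent, so pairing with tangent `ζ` suffices; there the `K` terms are
    -- symmetric in `X` and `Y` and cancel.
    refine (h.posDef x hx).eq_of_inner ?_ (lieBracket_mem_tangentSpace h.submanifold hX hY hx) ?_
    · rw [h.dirDeriv_add_christoffelMap hY hx hXx, h.dirDeriv_add_christoffelMap hX hx hYx]
      exact Submodule.sub_mem _ (Submodule.add_mem _ (metricProj_mem _ _ _) (metricProj_mem _ _ _))
        (Submodule.add_mem _ (metricProj_mem _ _ _) (metricProj_mem _ _ _))
    · intro ζ hζ
      rw [inner_sub_left, h.inner_dirDeriv_add_christoffelMap hY hx hXx hζ,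
        h.inner_dirDeriv_add_christoffelMap hX hx hYx hζ, inner_sub_left,
        h.inner_dirDeriv_comm hx hζ (X x) (Y x)]
      ring
  metric X Y Z hX hY hZ x hx := by
    have hXx := hX.tangent x hx
    have hYx := hY.tangent x hx
    have hZx := hZ.tangent x hx
    have h1 := dirDeriv_eq ((hasFDerivWithinAt_of_contDiffOn hY.smooth hx).inner ℝ
      ((hasFDerivWithinAt_of_contDiffOn h.smooth hx).clm_apply
        (hasFDerivWithinAt_of_contDiffOn hZ.smooth hx))) hXx
    -- By self-adjointness of the derivatives of `g`, the terms with `D_Y g` and `D_Z g` cancel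
    -- between the two Koszul formulas, and the two halves with `D_X g` add up to `⟪Y, (D_X g) Z⟫`.
    rw [h1, (h.posDef x hx).inner_apply (Y x), real_inner_comm (_ + _) (g x (Y x)),
      h.inner_dirDeriv_add_christoffelMap hY hx hXx hZx,
      h.inner_dirDeriv_add_christoffelMap hZ hx hXx hYx,
      h.inner_dirDeriv_comm hx hXx (Z x), h.inner_dirDeriv_comm hx hYx (X x),
      h.inner_dirDeriv_comm hx hZx (X x)]
    simp only [ContinuousLinearMap.comp_apply, ContinuousLinearMap.prod_apply, add_apply,
      ContinuousLinearMap.flip_apply, fderivInnerCLM_apply, inner_add_right,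
      (h.posDef x hx).inner_apply (Y x)]
    rw [real_inner_comm (fderivWithin ℝ Z M x (X x))]
    unfold dirDeriv
    ring

theorem isChristoffel_christoffelMap (h : IsAmbientStructure d M g) :
    IsChristoffel M g (christoffelMap M g) :=
  ⟨h.contDiffOn_christoffelMap, _, h.isLeviCivita_christoffelMap, fun _ _ _ _ _ _ => rfl⟩

/-- The Levi-Civita connection is unique. -/
theorem leviCivita_unique (h : IsAmbientStructure d M g) {D D' : (E → E) → (E → E) → E → E}
    (hD : IsLeviCivita M g D) (hD' : IsLeviCivita M g D') {X Y : E → E} (hX : IsVectorField M X)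
    (hY : IsVectorField M Y) {x : E} (hx : x ∈ M) : D X Y x = D' X Y x := by
  have hp := h.posDef x hx
  -- The difference of the connections is symmetric in its first two arguments (torsion) and skew in
  -- its last two (metric). Alternating the two relations six times returns `T X Y Z` with the
  -- opposite sign.
  set T : (E → E) → (E → E) → (E → E) → ℝ := fun X Y Z => ⟪D X Y x - D' X Y x, g x (Z x)⟫_ℝ
    with hT
  have hsymm : ∀ {X Y Z}, IsVectorField M X → IsVectorField M Y → T X Y Z = T Y X Z := by
    intro X Y Z hX hY
    have h1 := (hD.torsion_free X Y hX hY x hx).trans (hD'.torsion_free X Y hX hY x hx).symm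
    have h2 : D X Y x - D' X Y x = D Y X x - D' Y X x := by
      rw [sub_eq_sub_iff_add_eq_add] at h1 ⊢
      rw [h1, add_comm]
    simp only [hT, h2]
  have hskew : ∀ {X Y Z}, IsVectorField M X → IsVectorField M Y → IsVectorField M Z →
      T X Y Z = -T X Z Y := by
    intro X Y Z hX hY hZ
    have h1 := (hD.metric X Y Z hX hY hZ x hx).symm.trans (hD'.metric X Y Z hX hY hZ x hx)
    have h2 : ∀ w, ⟪Y x, g x w⟫_ℝ = ⟪w, g x (Y x)⟫_ℝ := fun w => by
      rw [hp.inner_apply, real_inner_comm]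
    rw [h2, h2] at h1
    simp only [hT, inner_sub_left]
    linarith
  have hzero : ∀ {X Y Z}, IsVectorField M X → IsVectorField M Y → IsVectorField M Z →
      T X Y Z = 0 := by
    intro X Y Z hX hY hZ
    have e1 := hskew hX hY hZ
    have e2 := hsymm (Z := Y) hX hZ
    have e3 := hskew hZ hX hY
    have e4 := hsymm (Z := X) hZ hY
    have e5 := hskew hY hZ hX
    have e6 := hsymm (Z := Z) hX hY
    linarith
  refine hp.eq_of_inner ((hD.isVectorField X Y hX hY).tangent x hx)
    ((hD'.isVectorField X Y hX hY).tangent x hx) fun ζ hζ => ?_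
  have := hzero hX hY (h.isVectorField_tangentProj ζ)
  simp only [hT, h.tangentProj_eq_self hx hζ, inner_sub_left] at this
  linarith

/-- Evaluate the unique connection on the fields `Π ξ` and `Π η`, whose values at `x` are `ξ` and
`η`: the term `D_X Y` is common to `Γ` and `christoffelMap` and cancels. -/
theorem christoffel_eq (h : IsAmbientStructure d M g) {𝒳 Γ : E → E →L[ℝ] E →L[ℝ] E}
    (h𝒳 : IsIndexRaised M g 𝒳) (hΓ : IsChristoffel M g Γ) {x : E} (hx : x ∈ M) {ξ η : E}
    (hξ : ξ ∈ tangentSpace M x) (hη : η ∈ tangentSpace M x) :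
    Γ x ξ η = -(dirDeriv M (tangentProj M g) x ξ η) + christoffelRing M g 𝒳 x ξ η := by
  obtain ⟨-, D, hD, hDΓ⟩ := hΓ
  have hX := h.isVectorField_tangentProj ξ
  have hY := h.isVectorField_tangentProj η
  have h1 := h.leviCivita_unique hD h.isLeviCivita_christoffelMap hX hY hx
  rw [hDΓ _ _ hX hY x hx, h.tangentProj_eq_self hx hξ, h.tangentProj_eq_self hx hη] at h1
  rw [add_left_cancel h1, h.christoffelMap_apply hx hξ hη,
    h.christoffelRing_eq h𝒳 h.isIndexRaised_indexRaised hx hξ hη]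

/-- The covariant derivative of a vector field along a tangent vector is tangent. -/
theorem dirDeriv_add_christoffel_mem (h : IsAmbientStructure d M g)
    {Γ : E → E →L[ℝ] E →L[ℝ] E} (hΓ : IsChristoffel M g Γ) {Y : E → E} (hY : IsVectorField M Y)
    {x : E} (hx : x ∈ M) {ξ : E} (hξ : ξ ∈ tangentSpace M x) :
    dirDeriv M Y x ξ + Γ x ξ (Y x) ∈ tangentSpace M x := by
  obtain ⟨-, D, hD, hDΓ⟩ := hΓ
  have hX := h.isVectorField_tangentProj ξ
  have h1 := (hD.isVectorField _ _ hX hY).tangent x hx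
  rwa [hDΓ _ _ hX hY x hx, h.tangentProj_eq_self hx hξ] at h1

end IsAmbientStructure

end Ambient

/-! ### Block operators on `E²` -/

section BlockOperators

variable {E : Type*} [NormedAddCommGroup E] [InnerProductSpace ℝ E]
variable {X : Type*} [NormedAddCommGroup X] [NormedSpace ℝ X]

/-- The continuous linear map from `E × E` to `E²`. -/
def toSq (E : Type*) [NormedAddCommGroup E] [InnerProductSpace ℝ E] : E × E →L[ℝ] Sq E :=
  ((WithLp.prodContinuousLinearEquiv 2 ℝ E E).symm : E × E →L[ℝ] Sq E)

theorem sq_ext {E : Type*} {u w : Sq E} (h₁ : u.fst = w.fst) (h₂ : u.snd = w.snd) : u = w :=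
  (WithLp.equiv 2 (E × E)).injective (Prod.ext h₁ h₂)

theorem fst_block (A B C D : E →L[ℝ] E) (u : Sq E) :
    (block A B C D u).fst = A u.fst + B u.snd := rfl

theorem snd_block (A B C D : E →L[ℝ] E) (u : Sq E) :
    (block A B C D u).snd = C u.fst + D u.snd := rfl

theorem inner_sq (u w : Sq E) : ⟪u, w⟫_ℝ = ⟪u.fst, w.fst⟫_ℝ + ⟪u.snd, w.snd⟫_ℝ :=
  WithLp.prod_inner_apply u w

/-- Exhibits the entries inside sums of compositions with constant operators, so smoothness passes
from the entries to the block. -/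
theorem block_eq (A B C D : E →L[ℝ] E) : block A B C D =
    (toSq E ∘L ContinuousLinearMap.inl ℝ E E) ∘L
      (A ∘L WithLp.fstL 2 ℝ E E + B ∘L WithLp.sndL 2 ℝ E E) +
    (toSq E ∘L ContinuousLinearMap.inr ℝ E E) ∘L
      (C ∘L WithLp.fstL 2 ℝ E E + D ∘L WithLp.sndL 2 ℝ E E) := by
  ext u
  refine sq_ext ?_ ?_
  · exact (add_zero _).symm
  · exact (zero_add _).symm

theorem contDiffOn_block {n : WithTop ℕ∞} {s : Set X} {A B C D : X → E →L[ℝ] E}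
    (hA : ContDiffOn ℝ n A s) (hB : ContDiffOn ℝ n B s) (hC : ContDiffOn ℝ n C s)
    (hD : ContDiffOn ℝ n D s) : ContDiffOn ℝ n (fun x => block (A x) (B x) (C x) (D x)) s := by
  simp only [block_eq]
  exact (contDiffOn_const.clm_comp ((hA.clm_comp contDiffOn_const).add
    (hB.clm_comp contDiffOn_const))).add (contDiffOn_const.clm_comp
      ((hC.clm_comp contDiffOn_const).add (hD.clm_comp contDiffOn_const)))

end BlockOperators

/-! ### The tangent bundle as a submanifold of `E²` and its tangent spaces -/

section Bundle

variable {E : Type*} [NormedAddCommGroup E] [InnerProductSpace ℝ E]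
variable {M : Set E} {φ : OpenPartialHomeomorph E E} {S : Submodule ℝ E}

theorem hasFDerivAt_fst (p : Sq E) :
    HasFDerivAt (fun q : Sq E => q.fst) (WithLp.fstL 2 ℝ E E) p :=
  (WithLp.fstL 2 ℝ E E).hasFDerivAt

theorem hasFDerivAt_snd (p : Sq E) :
    HasFDerivAt (fun q : Sq E => q.snd) (WithLp.sndL 2 ℝ E E) p :=
  (WithLp.sndL 2 ℝ E E).hasFDerivAt

theorem contDiff_fst_sq {n : WithTop ℕ∞} : ContDiff ℝ n (fun q : Sq E => q.fst) :=
  (WithLp.fstL 2 ℝ E E).contDiff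

theorem contDiff_snd_sq {n : WithTop ℕ∞} : ContDiff ℝ n (fun q : Sq E => q.snd) :=
  (WithLp.sndL 2 ℝ E E).contDiff

/-- The tangent map `(x, v) ↦ (f x, Df_x v)`. -/
def tangentMap (f : E → E) (p : Sq E) : Sq E :=
  WithLp.toLp 2 (f p.fst, fderiv ℝ f p.fst p.snd)

theorem contDiffOn_tangentMap {f : E → E} {U : Set E} (hU : IsOpen U)
    (hf : ContDiffOn ℝ ∞ f U) :
    ContDiffOn ℝ ∞ (tangentMap f) ((fun p : Sq E => p.fst) ⁻¹' U) := by
  have h1 : Set.MapsTo (fun p : Sq E => p.fst) ((fun p : Sq E => p.fst) ⁻¹' U) U :=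
    fun _ h => h
  exact (toSq E).contDiff.comp_contDiffOn ((hf.comp contDiff_fst_sq.contDiffOn h1).prodMk
    (((hf.fderiv_of_isOpen hU (m := ∞) (by simp)).comp contDiff_fst_sq.contDiffOn h1).clm_apply
      contDiff_snd_sq.contDiffOn))

/-- The diffeomorphism of tangent bundles induced by a diffeomorphism. -/
def IsStraightening.bundleChart (h : IsStraightening M φ S) :
    OpenPartialHomeomorph (Sq E) (Sq E) where
  toFun := tangentMap φ
  invFun := tangentMap φ.symm
  source := (fun p : Sq E => p.fst) ⁻¹' φ.source
  target := (fun p : Sq E => p.fst) ⁻¹' φ.target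
  map_source' _ hp := φ.map_source hp
  map_target' _ hp := φ.map_target hp
  left_inv' p hp := sq_ext (φ.left_inv hp) (h.fderiv_symm_fderiv hp p.snd)
  right_inv' p hp := sq_ext (φ.right_inv hp) (h.fderiv_fderiv_symm hp p.snd)
  continuousOn_toFun := (contDiffOn_tangentMap φ.open_source h.contDiffOn).continuousOn
  continuousOn_invFun := (contDiffOn_tangentMap φ.open_target h.contDiffOn_symm).continuousOn
  open_source := φ.open_source.preimage (contDiff_fst_sq (n := 0)).continuous
  open_target := φ.open_target.preimage (contDiff_fst_sq (n := 0)).continuous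

/-- The subspace `S × S` of `E²`. -/
def sqSubspace (S : Submodule ℝ E) : Submodule ℝ (Sq E) :=
  (S.prod S).comap (WithLp.prodContinuousLinearEquiv 2 ℝ E E).toLinearEquiv.toLinearMap

theorem dirDeriv_fst {p ξ : Sq E} (hξ : ξ ∈ tangentSpace (tangentBundle M) p) :
    dirDeriv (tangentBundle M) (fun q => q.fst) p ξ = ξ.fst :=
  dirDeriv_eq (hasFDerivAt_fst p).hasFDerivWithinAt hξ

theorem contDiffOn_gammaOp {Γ : E → E →L[ℝ] E →L[ℝ] E} (hΓ : ContDiffOn ℝ ∞ Γ M) :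
    ContDiffOn ℝ ∞ (gammaOp Γ) (tangentBundle M) :=
  (contDiffOn_flip (hΓ.comp contDiff_fst_sq.contDiffOn fun _ hp => hp.1)).clm_apply
    contDiff_snd_sq.contDiffOn

variable [FiniteDimensional ℝ E]

theorem finrank_sqSubspace (S : Submodule ℝ E) :
    Module.finrank ℝ (sqSubspace S) = 2 * Module.finrank ℝ S := by
  have e : sqSubspace S ≃ₗ[ℝ] S × S :=
    { toFun := fun u => (⟨u.1.fst, u.2.1⟩, ⟨u.1.snd, u.2.2⟩)
      invFun := fun w => ⟨WithLp.toLp 2 (w.1.1, w.2.1), w.1.2, w.2.2⟩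
      map_add' := fun _ _ => rfl
      map_smul' := fun _ _ => rfl
      left_inv := fun _ => rfl
      right_inv := fun _ => rfl }
  rw [e.finrank_eq, Module.finrank_prod, two_mul]

/-- Over a point of `M`, the fibre condition `v ∈ T_x M` is `Dφ v ∈ S`, so the tangent map of `φ`
takes both conditions to membership in `S`. -/
theorem IsStraightening.tangentBundle (h : IsStraightening M φ S) :
    IsStraightening (tangentBundle M) h.bundleChart (sqSubspace S) where
  contDiffOn := contDiffOn_tangentMap φ.open_source h.contDiffOn
  contDiffOn_symm := contDiffOn_tangentMap φ.open_target h.contDiffOn_symm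
  mem_iff p hp := by
    have hp' : p.fst ∈ φ.source := hp
    change p.fst ∈ M ∧ p.snd ∈ tangentSpace M p.fst ↔ φ p.fst ∈ S ∧ fderiv ℝ φ p.fst p.snd ∈ S
    rw [← h.mem_iff _ hp']
    exact and_congr_right fun hM => h.mem_tangentSpace_iff hp' hM _

theorem isSubmanifold_tangentBundle {d : ℕ} (hM : IsSubmanifold d M) :
    IsSubmanifold (2 * d) (tangentBundle M) := by
  intro p hp
  obtain ⟨φ, S, hxs, hS, hφ⟩ := hM.exists_straightening hp.1
  exact ⟨hφ.bundleChart, sqSubspace S, hxs, by rw [finrank_sqSubspace, hS],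
    hφ.tangentBundle.contDiffOn, hφ.tangentBundle.contDiffOn_symm, hφ.tangentBundle.mem_iff⟩

/-- The tangent spaces of the tangent bundle. -/
theorem mem_tangentSpace_tangentBundle {d : ℕ} {g : E → E →L[ℝ] E}
    (hg : IsAmbientStructure d M g) {Γ : E → E →L[ℝ] E →L[ℝ] E} (hΓ : IsChristoffel M g Γ)
    {p : Sq E} (hp : p ∈ tangentBundle M) (u : Sq E) :
    u ∈ tangentSpace (tangentBundle M) p ↔ u.fst ∈ tangentSpace M p.fst ∧
      u.snd + gammaOp Γ p u.fst ∈ tangentSpace M p.fst := by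
  obtain ⟨φ, S, hxs, -, hφ⟩ := hg.submanifold.exists_straightening hp.1
  have hd : HasFDerivAt (tangentMap φ) (toSq E ∘L (fderiv ℝ φ p.fst ∘L WithLp.fstL 2 ℝ E E).prod
      (fderiv ℝ φ p.fst ∘L WithLp.sndL 2 ℝ E E +
        (fderiv ℝ (fderiv ℝ φ) p.fst ∘L WithLp.fstL 2 ℝ E E).flip p.snd)) p :=
    (toSq E).hasFDerivAt.comp p
      ((HasFDerivAt.comp p (hφ.hasFDerivAt hxs) (hasFDerivAt_fst p)).prodMk
        ((HasFDerivAt.comp p (hφ.hasFDerivAt_fderiv hxs) (hasFDerivAt_fst p)).clm_apply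
          (hasFDerivAt_snd p)))
  rw [hφ.tangentBundle.mem_tangentSpace_iff hxs hp]
  change fderiv ℝ (tangentMap φ) p u ∈ _ ↔ _
  rw [hd.fderiv]
  change fderiv ℝ φ p.fst u.fst ∈ S ∧ fderiv ℝ φ p.fst u.snd +
    fderiv ℝ (fderiv ℝ φ) p.fst u.fst p.snd ∈ S ↔ _
  rw [← hφ.mem_tangentSpace_iff hxs hp.1]
  refine and_congr_right fun hu => ?_
  -- A vector field with value `v` at `x`. Combining its differentiated tangency equation with the
  -- tangency of its covariant derivative yields `D²φ(a, v) - Dφ Γ(a, v) ∈ S`, which trades one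
  -- correction term for the other.
  have hY := hg.isVectorField_tangentProj p.snd
  have h1 := hφ.fderiv_dirDeriv_add_mem hxs hp.1 hY hu
  have h2 := hg.dirDeriv_add_christoffel_mem hΓ hY hp.1 hu
  rw [hg.tangentProj_eq_self hp.1 hp.2] at h1 h2
  rw [hφ.mem_tangentSpace_iff hxs hp.1, map_add] at h2
  rw [hφ.mem_tangentSpace_iff hxs hp.1, map_add]
  have h3 := S.sub_mem h1 h2
  rw [add_sub_add_left_eq_sub] at h3
  have h4 : fderiv ℝ φ p.fst u.snd + fderiv ℝ (fderiv ℝ φ) p.fst u.fst p.snd =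
      fderiv ℝ φ p.fst u.snd + fderiv ℝ φ p.fst (Γ p.fst u.fst p.snd) +
        (fderiv ℝ (fderiv ℝ φ) p.fst u.fst p.snd - fderiv ℝ φ p.fst (Γ p.fst u.fst p.snd)) := by
    abel
  rw [h4]
  exact S.add_mem_iff_left h3

end Bundle

/-! ### The natural metric operator: positivity, inverse, submersion, projection -/

section NaturalMetric

variable {E : Type*} [NormedAddCommGroup E] [InnerProductSpace ℝ E] [FiniteDimensional ℝ E]
variable {d : ℕ} {M : Set E} {g : E → E →L[ℝ] E} {Γ : E → E →L[ℝ] E →L[ℝ] E}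
variable {gh : Sq E → E →L[ℝ] E}

theorem IsPosDefOp.nonneg {A : E →L[ℝ] E} (hA : IsPosDefOp A) (u : E) : 0 ≤ ⟪u, A u⟫_ℝ := by
  rcases eq_or_ne u 0 with rfl | hu
  · simp
  · exact (hA.pos u hu).le

theorem naturalOp_apply (p u : Sq E) : naturalOp g Γ gh p u =
    WithLp.toLp 2 (g p.fst u.fst + (gammaOp Γ p).adjoint (gh p (u.snd + gammaOp Γ p u.fst)),
      gh p (u.snd + gammaOp Γ p u.fst)) := by
  refine sq_ext ?_ ?_ <;>
  simp [naturalOp, fst_block, snd_block, add_comm]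

/-- The outer factor of `G` is the adjoint of the shear, so `G` is the pullback of `diag(g, ĝ)`
under the shear. -/
theorem inner_naturalOp (p w u : Sq E) : ⟪w, naturalOp g Γ gh p u⟫_ℝ =
    ⟪w.fst, g p.fst u.fst⟫_ℝ +
      ⟪w.snd + gammaOp Γ p w.fst, gh p (u.snd + gammaOp Γ p u.fst)⟫_ℝ := by
  rw [naturalOp_apply, inner_sq, inner_add_left]
  change ⟪w.fst, _ + _⟫_ℝ + ⟪w.snd, gh p (u.snd + gammaOp Γ p u.fst)⟫_ℝ = _
  rw [inner_add_right, ContinuousLinearMap.adjoint_inner_right]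
  ring

theorem isPosDefOp_naturalOp {p : Sq E} (hg : IsPosDefOp (g p.fst)) (hgh : IsPosDefOp (gh p)) :
    IsPosDefOp (naturalOp g Γ gh p) where
  selfAdjoint := by
    rw [ContinuousLinearMap.isSelfAdjoint_iff_isSymmetric]
    intro u w
    change ⟪naturalOp g Γ gh p u, w⟫_ℝ = ⟪u, naturalOp g Γ gh p w⟫_ℝ
    rw [real_inner_comm, inner_naturalOp, inner_naturalOp, hg.inner_apply, hgh.inner_apply,
      real_inner_comm, real_inner_comm (gh p _)]
  pos u hu := by
    rw [inner_naturalOp]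
    -- If the first component vanishes, the shear fixes the vector and the `ĝ` term is positive;
    -- otherwise the `g` term already is.
    by_cases h : u.fst = 0
    · have h2 : u.snd ≠ 0 := fun h2 => hu (sq_ext h h2)
      simpa [h] using hgh.pos _ h2
    · exact add_pos_of_pos_of_nonneg (hg.pos _ h) (hgh.nonneg _)

/-- Invertibility is known from positivity, so it is enough that `G` sends the candidate's value
back to `u`. -/
theorem inverse_naturalOp {p : Sq E} (hg : IsPosDefOp (g p.fst)) (hgh : IsPosDefOp (gh p)) :
    (naturalOp g Γ gh p).inverse = block 1 0 (-gammaOp Γ p) 1 ∘L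
      block (g p.fst).inverse 0 0 (gh p).inverse ∘L block 1 (-(gammaOp Γ p).adjoint) 0 1 := by
  have h1 : ∀ a, g p.fst ((g p.fst).inverse a) = a := fun a =>
    (hg.isInvertible.inverse_apply_eq.1 rfl).symm
  have h2 : ∀ a, gh p ((gh p).inverse a) = a := fun a =>
    (hgh.isInvertible.inverse_apply_eq.1 rfl).symm
  ext u
  rw [(isPosDefOp_naturalOp hg hgh).isInvertible.inverse_apply_eq, naturalOp_apply]
  refine sq_ext ?_ ?_ <;>
  · simp [fst_block, snd_block, h1, h2]
    abel

theorem contDiffOn_naturalOp (hg : ContDiffOn ℝ ∞ g M) (hΓ : ContDiffOn ℝ ∞ Γ M)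
    (hgh : ContDiffOn ℝ ∞ gh (tangentBundle M)) :
    ContDiffOn ℝ ∞ (naturalOp g Γ gh) (tangentBundle M) := by
  have hc := contDiffOn_gammaOp hΓ
  have hc' : ContDiffOn ℝ ∞ (fun p => (gammaOp Γ p).adjoint) (tangentBundle M) :=
    fun p hp => contDiffWithinAt_adjoint (hc p hp)
  exact (contDiffOn_block contDiffOn_const hc' contDiffOn_const contDiffOn_const).clm_comp
    ((contDiffOn_block (hg.comp contDiff_fst_sq.contDiffOn fun _ hp => hp.1) contDiffOn_const
      contDiffOn_const hgh).clm_comp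
        (contDiffOn_block contDiffOn_const contDiffOn_const hc contDiffOn_const))

theorem isAmbientStructure_naturalOp (hg : IsAmbientStructure d M g) (hΓ : IsChristoffel M g Γ)
    (hgh : ContDiffOn ℝ ∞ gh (tangentBundle M))
    (hgh_pos : ∀ p ∈ tangentBundle M, IsPosDefOp (gh p)) {G : Sq E → Sq E →L[ℝ] Sq E}
    (hG : ∀ p ∈ tangentBundle M, G p = naturalOp g Γ gh p) :
    IsAmbientStructure (2 * d) (tangentBundle M) G where
  submanifold := isSubmanifold_tangentBundle hg.submanifold
  smooth := (contDiffOn_naturalOp hg.smooth hΓ.1 hgh).congr hG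
  posDef p hp := by
    rw [hG p hp]
    exact isPosDefOp_naturalOp (hg.posDef _ hp.1) (hgh_pos p hp)

/-- The horizontal component of a tangent vector is tangent. -/
theorem horizontal_mem (hg : IsAmbientStructure d M g) (hΓ : IsChristoffel M g Γ) {p : Sq E}
    (hp : p ∈ tangentBundle M) {a : E} (ha : a ∈ tangentSpace M p.fst) :
    WithLp.toLp 2 (a, -gammaOp Γ p a) ∈ tangentSpace (tangentBundle M) p := by
  rw [mem_tangentSpace_tangentBundle hg hΓ hp]
  refine ⟨ha, ?_⟩
  change -gammaOp Γ p a + gammaOp Γ p a ∈ _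
  rw [neg_add_cancel]
  exact Submodule.zero_mem _

/-- Vertical vectors are tangent. -/
theorem vertical_mem (hg : IsAmbientStructure d M g) (hΓ : IsChristoffel M g Γ) {p : Sq E}
    (hp : p ∈ tangentBundle M) {b : E} (hb : b ∈ tangentSpace M p.fst) :
    WithLp.toLp 2 (0, b) ∈ tangentSpace (tangentBundle M) p := by
  rw [mem_tangentSpace_tangentBundle hg hΓ hp]
  refine ⟨Submodule.zero_mem _, ?_⟩
  change b + gammaOp Γ p 0 ∈ _
  rwa [map_zero, add_zero]

theorem isRiemannianSubmersion_fst (hg : IsAmbientStructure d M g) (hΓ : IsChristoffel M g Γ)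
    (hgh_pos : ∀ p ∈ tangentBundle M, IsPosDefOp (gh p)) {G : Sq E → Sq E →L[ℝ] Sq E}
    (hG : ∀ p ∈ tangentBundle M, G p = naturalOp g Γ gh p) :
    IsRiemannianSubmersion (tangentBundle M) G M g (fun p => p.fst) where
  smooth := contDiff_fst_sq.contDiffOn
  image_eq := by
    refine Set.Subset.antisymm ?_ fun x hx => ⟨WithLp.toLp 2 (x, 0), ⟨hx, Submodule.zero_mem _⟩, rfl⟩
    rintro _ ⟨p, hp, rfl⟩
    exact hp.1
  map_tangent p hp := by
    refine Set.Subset.antisymm ?_ fun a ha => ?_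
    · rintro _ ⟨ξ, hξ, rfl⟩
      rw [dirDeriv_fst hξ]
      exact ((mem_tangentSpace_tangentBundle hg hΓ hp ξ).1 hξ).1
    · have h := horizontal_mem hg hΓ hp ha
      exact ⟨_, h, dirDeriv_fst h⟩
  isometry p hp ξ hξ η hη hξ' _ := by
    have h1 := ((mem_tangentSpace_tangentBundle hg hΓ hp ξ).1 hξ).2
    -- The vertical component of `ξ` lies in the kernel of `dπ`. Testing orthogonality against it
    -- makes its own `ĝ` norm vanish, so `ξ` is horizontal and only the `g` term survives.
    have h2 := vertical_mem hg hΓ hp h1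
    have h3 := hξ' _ h2 (dirDeriv_fst h2)
    have h4 : ξ.snd + gammaOp Γ p ξ.fst = 0 := by
      rw [hG p hp, inner_naturalOp] at h3
      refine (hgh_pos p hp).eq_zero_of_inner ?_
      simpa using h3
    rw [dirDeriv_fst hξ, dirDeriv_fst hη, hG p hp, inner_naturalOp, h4, inner_zero_left, add_zero]

/-- After the shear, the tangent space and the metric both split, so the projection is `Π_g` on the
first factor and `Π_ĝ` on the second. Undoing the shear subtracts `Γ[v] Π_g`; the defining property
of the projection confirms it. -/
theorem tangentProj_naturalOp_apply (hg : IsAmbientStructure d M g) (hΓ : IsChristoffel M g Γ)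
    (hgh_pos : ∀ p ∈ tangentBundle M, IsPosDefOp (gh p)) {G : Sq E → Sq E →L[ℝ] Sq E}
    (hG : ∀ p ∈ tangentBundle M, G p = naturalOp g Γ gh p) {p : Sq E}
    (hp : p ∈ tangentBundle M) (u : Sq E) :
    tangentProj (tangentBundle M) G p u = WithLp.toLp 2 (tangentProj M g p.fst u.fst,
      metricProj (gh p) (tangentSpace M p.fst) (u.snd + gammaOp Γ p u.fst) -
        gammaOp Γ p (tangentProj M g p.fst u.fst)) := by
  symm
  refine eq_metricProj ?_ _ _ _ ?_ fun η hη => ?_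
  · rw [hG p hp]
    exact isPosDefOp_naturalOp (hg.posDef _ hp.1) (hgh_pos p hp)
  · rw [mem_tangentSpace_tangentBundle hg hΓ hp]
    refine ⟨metricProj_mem _ _ _, ?_⟩
    change _ - _ + gammaOp Γ p (tangentProj M g p.fst u.fst) ∈ _
    rw [sub_add_cancel]
    exact metricProj_mem _ _ _
  · obtain ⟨h1, h2⟩ := (mem_tangentSpace_tangentBundle hg hΓ hp η).1 hη
    rw [hG p hp, inner_naturalOp, inner_naturalOp]
    change ⟪tangentProj M g p.fst u.fst, _⟫_ℝ +
      ⟪_ - _ + gammaOp Γ p (tangentProj M g p.fst u.fst), _⟫_ℝ = _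
    rw [sub_add_cancel, inner_metricProj (hgh_pos p hp) _ _ _ h2, tangentProj,
      inner_metricProj (hg.posDef _ hp.1) _ _ _ h1]

end NaturalMetric

end AmbientGeometry

end

/-! ### The main theorem -/

open AmbientGeometry in
theorem mainTheorem9 {E : Type*} [NormedAddCommGroup E] [InnerProductSpace ℝ E]
    [FiniteDimensional ℝ E] (d : ℕ) (M : Set E) (g : E → E →L[ℝ] E)
    (hg : IsAmbientStructure d M g)
    (Γ : E → E →L[ℝ] E →L[ℝ] E) (hΓ : IsChristoffel M g Γ)
    (gh : Sq E → E →L[ℝ] E) (hgh_smooth : ContDiffOn ℝ ∞ gh (tangentBundle M))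
    (hgh_pos : ∀ p ∈ tangentBundle M, IsPosDefOp (gh p))
    (G : Sq E → Sq E →L[ℝ] Sq E) (hG : ∀ p ∈ tangentBundle M, G p = naturalOp g Γ gh p) :
    -- `(TM, G, E²)` is an embedded ambient structure
    IsAmbientStructure (2 * d) (tangentBundle M) G ∧
    -- the inverse of `G`
    (∀ p ∈ tangentBundle M, (G p).IsInvertible ∧
      (G p).inverse =
        block 1 0 (-gammaOp Γ p) 1 ∘L block (g p.fst).inverse 0 0 (gh p).inverse ∘L
          block 1 (-(gammaOp Γ p).adjoint) 0 1) ∧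
    -- vertical and horizontal components of tangent vectors, and their orthogonality
    (∀ x v : E, WithLp.toLp 2 (x, v) ∈ tangentBundle M → ∀ a b : E,
      WithLp.toLp 2 (a, b) ∈ tangentSpace (tangentBundle M) (WithLp.toLp 2 (x, v)) →
      WithLp.toLp 2 (0, b + Γ x a v) ∈
        tangentSpace (tangentBundle M) (WithLp.toLp 2 (x, v)) ∧
      WithLp.toLp 2 (a, -Γ x a v) ∈
        tangentSpace (tangentBundle M) (WithLp.toLp 2 (x, v)) ∧
      ∀ a' b' : E,
        WithLp.toLp 2 (a', b') ∈ tangentSpace (tangentBundle M) (WithLp.toLp 2 (x, v)) →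
        ⟪(WithLp.toLp 2 (0, b + Γ x a v) : Sq E),
          G (WithLp.toLp 2 (x, v)) (WithLp.toLp 2 (a', -Γ x a' v))⟫_ℝ = 0) ∧
    -- `π : TM → M` is a Riemannian submersion
    IsRiemannianSubmersion (tangentBundle M) G M g (fun p => p.fst) ∧
    -- the projection `Π_G`
    ContDiffOn ℝ ∞ (tangentProj (tangentBundle M) G) (tangentBundle M) ∧
    (∀ p ∈ tangentBundle M,
      tangentProj (tangentBundle M) G p =
        block 1 0 (-gammaOp Γ p) 1 ∘L
          block (tangentProj M g p.fst) 0 0 (metricProj (gh p) (tangentSpace M p.fst)) ∘L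
          block 1 0 (gammaOp Γ p) 1) ∧
    (∀ p ∈ tangentBundle M, ∀ a b : E,
      tangentProj (tangentBundle M) G p (WithLp.toLp 2 (a, b)) =
        WithLp.toLp 2 (tangentProj M g p.fst a,
          (-(gammaOp Γ p ∘L tangentProj M g p.fst) +
            metricProj (gh p) (tangentSpace M p.fst) ∘L gammaOp Γ p) a +
            metricProj (gh p) (tangentSpace M p.fst) b)) ∧
    -- Christoffel functions of `G`
    (∃ 𝒳 : Sq E → Sq E →L[ℝ] Sq E →L[ℝ] Sq E,
      IsSmoothBilinear (tangentBundle M) 𝒳 ∧ IsIndexRaised (tangentBundle M) G 𝒳) ∧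
    (∃ ΓG, IsChristoffel (tangentBundle M) G ΓG) ∧
    (∀ 𝒳 ΓG, IsIndexRaised (tangentBundle M) G 𝒳 → IsChristoffel (tangentBundle M) G ΓG →
      ∀ p ∈ tangentBundle M, ∀ ξ ∈ tangentSpace (tangentBundle M) p,
        ∀ η ∈ tangentSpace (tangentBundle M) p,
        ΓG p ξ η = -(dirDeriv (tangentBundle M) (tangentProj (tangentBundle M) G) p ξ η) +
          christoffelRing (tangentBundle M) G 𝒳 p ξ η) := by
  have hGA := isAmbientStructure_naturalOp hg hΓ hgh_smooth hgh_pos hG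
  have hproj := fun {p : Sq E} (hp : p ∈ tangentBundle M) (u : Sq E) =>
    tangentProj_naturalOp_apply hg hΓ hgh_pos hG hp u
  refine ⟨hGA, fun p hp => ⟨(hGA.posDef p hp).isInvertible, ?_⟩, ?_,
    isRiemannianSubmersion_fst hg hΓ hgh_pos hG, hGA.contDiffOn_tangentProj, ?_, ?_,
    ⟨_, hGA.isSmoothBilinear_indexRaised, hGA.isIndexRaised_indexRaised⟩,
    ⟨_, hGA.isChristoffel_christoffelMap⟩, ?_⟩
  · rw [hG p hp, inverse_naturalOp (hg.posDef _ hp.1) (hgh_pos p hp)]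
  · intro x v hp a b hab
    obtain ⟨ha, hb⟩ := (mem_tangentSpace_tangentBundle hg hΓ hp _).1 hab
    refine ⟨vertical_mem hg hΓ hp hb, horizontal_mem hg hΓ hp ha, fun a' b' _ => ?_⟩
    rw [hG _ hp, inner_naturalOp]
    -- The vertical vector has no first component and the horizontal one no second component after
    -- the shear, so both summands vanish.
    change ⟪(0 : E), _⟫_ℝ + ⟪_, gh _ (-Γ x a' v + Γ x a' v)⟫_ℝ = 0
    rw [inner_zero_left, neg_add_cancel, map_zero, inner_zero_right, add_zero]
  · intro p hp
    ext u
    rw [hproj hp u]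
    refine sq_ext ?_ ?_
    · simp [fst_block]
    · simp [fst_block, snd_block]
      abel
  · intro p hp a b
    rw [hproj hp]
    refine sq_ext rfl ?_
    simp
    abel
  · intro 𝒳 ΓG h𝒳 hΓG p hp ξ hξ η hη
    exact hGA.christoffel_eq h𝒳 hΓG hp hξ hη
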